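/- Let $\Bbbk$ be a subfield of $\mathbb R$ (or, more generally, any ordered field), $V$ a finite-dimensional $\Bbbk$-vector space, and $\Phi\subset V^\star$ a finite reduced root system, not necessarily crystallographic and not necessarily spanning $V^\star$. Let $W$ be the finite reflection group generated by the reflections in the roots, acting on $\Bbbk[V]=\mathrm{Sym}(V^\star)$. Fix a chamber $\mathcal C$ in the complement of the reflecting hyperplanes. Let $\Phi^+$ be the set of roots that are positive on $\mathcal C$, let $S$ be the set of reflections across the facets of $\mathcal C$, and for $s\in S$ let $\alpha_s\in\Phi^+$ be the root vanishing on the hyperplane of $s$. Let $\ell$ be the length with respect to $S$, and $w_0$ the longest element of $W$. Put $\partial_s(f)=\dfrac{f-s(f)}{\alpha_s}$, put $\partial_w=\partial_{s_1}\cdots\partial_{s_\ell}$ for a reduced decomposition $w=s_1\cdots s_\ell$, and define the Hiller Schubert polynomials by $$S_{w_0}=\frac1{|W|}\prod_{\alpha\in\Phi^+}\alpha,\qquad S_w=\partial_{w^{-1}w_0}S_{w_0}\quad(w\in W).$$ Let $(\Bbbk[V]^W_+)$ be the ideal of $\Bbbk[V]$ generated by the $W$-invariants of positive degree. Then for all $u,v\in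 W$ there is a unique family $(c_{u,v}^w)_{w\in W}$ in $\Bbbk$ (the Schubert structure constants) with $$S_uS_v\equiv\sum_{w\in W}c_{u,v}^w\,S_w \mod (\Bbbk[V]^W_+),$$ and $c_{u,v}^w=0$ unless $\ell(w)=\ell(u)+\ell(v)$. Moreover, let $J\subseteq S$, let $W_J$ be the subgroup generated by $J$, and let $W^J$ be the set of elements $u\in W$ that have minimum length in their coset $uW_J$. If $w=u\cdot x$ and $w'=u\cdot x'$ with $u\in W^J$ and $x,x'\in W_J$, then $$c_{u,x}^{w'}=\delta_{w',w}=\delta_{x',x}.$$ -/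

import Mathlib

noncomputable section

namespace HillerSchubert

variable {ι 𝕜 M N : Type*} [Field 𝕜]
  [AddCommGroup M] [Module 𝕜 M] [AddCommGroup N] [Module 𝕜 N]

/-! Throughout, `N` is the reflection representation `V`, `M` is its dual `V⋆`, the roots lie in `M`,
and `W = P.weylGroup` is the finite reflection group generated by the reflections in the roots.
The root pairing is not assumed to be crystallographic. The dominant chamber is given by one of
its points `ρ`. -/

section Group

variable (P : RootPairing ι 𝕜 M N)

/-- The reflection in the root with index `i`, as an element of `W`. -/
def refl (i : ι) : P.weylGroup := RootPairing.weylGroup.ofIdx P i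

/-- The parabolic subgroup `W_J`. -/
def parabolic (J : Set ι) : Subgroup P.weylGroup := Subgroup.closure (refl P '' J)

theorem smul_eq_self_of_coroot_eq_zero (w : P.weylGroup) (m : M) (hm : ∀ i, P.coroot' i m = 0) :
    w • m = m := by
  obtain ⟨w, hw⟩ := w
  induction hw using RootPairing.weylGroup.induction with
  | mem i =>
    change P.reflection i m = m
    rw [RootPairing.reflection_apply, hm i, zero_smul, sub_zero]
  | one => exact one_smul _ m
  | mul x y hx hy h1 h2 =>
    rw [← Submonoid.mk_mul_mk _ _ _ hx hy, mul_smul, h2, h1]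

/-! ### The polynomial ring `𝕜[V] = Sym(V⋆)` -/

/-- The action of `W` on `𝕜[V]` by algebra automorphisms, extending the one on `V⋆`. -/
def polyAct (w : P.weylGroup) : SymmetricAlgebra 𝕜 M →ₐ[𝕜] SymmetricAlgebra 𝕜 M :=
  SymmetricAlgebra.lift (SymmetricAlgebra.ι 𝕜 M ∘ₗ P.weylGroupRootRep w)

/-- The root with index `i`, as an element of `𝕜[V]`. -/
def rootPoly (i : ι) : SymmetricAlgebra 𝕜 M := SymmetricAlgebra.ι 𝕜 M (P.root i)

theorem rootPoly_dvd (i : ι) (f : SymmetricAlgebra 𝕜 M) :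
    rootPoly P i ∣ f - polyAct P (refl P i) f := by
  induction f using SymmetricAlgebra.induction with
  | algebraMap r => simp
  | ι x =>
    refine ⟨algebraMap 𝕜 _ (P.coroot' i x), ?_⟩
    have h : P.weylGroupRootRep (refl P i) x = x - P.coroot' i x • P.root i := by
      change P.reflection i x = _
      rw [RootPairing.reflection_apply]
    simp only [polyAct, SymmetricAlgebra.lift_ι_apply, LinearMap.comp_apply, h, map_sub, map_smul,
      rootPoly]
    rw [sub_sub_cancel, Algebra.smul_def, mul_comm]
  | mul a b ha hb =>
    have : a * b - polyAct P (refl P i) (a * b) =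
        (a - polyAct P (refl P i) a) * b + polyAct P (refl P i) a * (b - polyAct P (refl P i) b) := by
      rw [map_mul]; ring
    rw [this]
    exact dvd_add (ha.mul_right _) (hb.mul_left _)
  | add a b ha hb =>
    have : a + b - polyAct P (refl P i) (a + b) =
        (a - polyAct P (refl P i) a) + (b - polyAct P (refl P i) b) := by
      rw [map_add]; ring
    rw [this]
    exact dvd_add ha hb

/-- The divided difference `∂_s f = (f - s f) / α_s`, for `s` the reflection in the root `α_s` with
index `i`. -/
def divDiff (i : ι) (f : SymmetricAlgebra 𝕜 M) : SymmetricAlgebra 𝕜 M :=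
  (rootPoly_dvd P i f).choose

/-- The defining property of `divDiff`; it determines it, because `𝕜[V]` is a domain. -/
theorem rootPoly_mul_divDiff (i : ι) (f : SymmetricAlgebra 𝕜 M) :
    rootPoly P i * divDiff P i f = f - polyAct P (refl P i) f :=
  (rootPoly_dvd P i f).choose_spec.symm

/-- The ideal of `𝕜[V]` generated by the homogeneous `W`-invariants of positive degree; the
homogeneous elements of degree `n` form the `n`-th power of the subspace `V⋆`. -/
def invariantIdeal : Ideal (SymmetricAlgebra 𝕜 M) :=
  Ideal.span {f | (∃ n : ℕ, 0 < n ∧ f ∈ LinearMap.range (SymmetricAlgebra.ι 𝕜 M) ^ n) ∧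
    ∀ w : P.weylGroup, polyAct P w f = f}

/-- The coinvariant algebra. -/
abbrev Coinvariant : Type _ := SymmetricAlgebra 𝕜 M ⧸ invariantIdeal P

end Group

/-! ### Chambers, simple reflections and length -/

variable [LinearOrder 𝕜] [IsStrictOrderedRing 𝕜] (P : RootPairing ι 𝕜 M N) (ρ : N)

/-- `ρ` lies on no reflecting hyperplane, that is, in the interior of a chamber. -/
def IsRegular : Prop := ∀ i, P.root' i ρ ≠ 0

/-- The root with index `i` is positive on the chamber of `ρ`. -/
def IsPos (i : ι) : Prop := 0 < P.root' i ρ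

/-- The (indices of) simple roots: the positive roots whose hyperplane is a facet of the chamber
of `ρ`, that is, has a point where all the other positive roots are positive. -/
def simple : Set ι :=
  {i | IsPos P ρ i ∧ ∃ v : N, P.root' i v = 0 ∧ ∀ j, IsPos P ρ j → j ≠ i → 0 < P.root' j v}

/-- The product of the reflections named by a word in the simple roots. -/
def wordProd (l : List (simple P ρ)) : P.weylGroup := (l.map fun i => refl P i).prod

/-- The Coxeter length with respect to the simple reflections. -/
def length (w : P.weylGroup) : ℕ := sInf {n | ∃ l, wordProd P ρ l = w ∧ l.length = n}

/-- `l` is a reduced decomposition of `w`. -/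
def IsReducedWord (l : List (simple P ρ)) (w : P.weylGroup) : Prop :=
  wordProd P ρ l = w ∧ l.length = length P ρ w

open Classical in
/-- A chosen reduced decomposition of `w`. -/
def reducedWord (w : P.weylGroup) : List (simple P ρ) :=
  if h : ∃ l, IsReducedWord P ρ l w then h.choose else []

/-- `W^J`: the elements of minimum length in their coset `u W_J`. -/
def minCosetReps (J : Set ι) : Set P.weylGroup :=
  {u | ∀ x ∈ parabolic P J, length P ρ u ≤ length P ρ (u * x)}

/-! ### Schubert polynomials and structure constants -/

/-- `∂_{s₁} ⋯ ∂_{s_l} f` for a word `s₁ ⋯ s_l`. -/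
def divDiffWord (l : List (simple P ρ)) (f : SymmetricAlgebra 𝕜 M) : SymmetricAlgebra 𝕜 M :=
  l.foldr (fun i g => divDiff P i g) f

/-- The divided difference `∂_w`, through a reduced decomposition of `w`. -/
def divDiffElt (w : P.weylGroup) (f : SymmetricAlgebra 𝕜 M) : SymmetricAlgebra 𝕜 M :=
  divDiffWord P ρ (reducedWord P ρ w) f

variable [Fintype ι]

instance finite_weylGroup : Finite P.weylGroup := by
  refine Finite.of_injective P.weylGroupToPerm ?_
  rw [injective_iff_map_eq_one]
  intro w hw
  have key : ∀ m : M, w • m = m := by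
    intro m
    have hm : m ∈ P.rootSpan 𝕜 ⊔ LinearMap.ker P.RootForm := by
      rw [P.isCompl_rootSpan_ker_rootForm.sup_eq_top]; trivial
    obtain ⟨a, ha, b, hb, rfl⟩ := Submodule.mem_sup.mp hm
    rw [smul_add]
    congr 1
    · clear hm
      induction ha using Submodule.span_induction with
      | mem x hx =>
        obtain ⟨i, rfl⟩ := hx
        rw [P.weylGroup_apply_root, hw]; rfl
      | zero => exact smul_zero _
      | add x y _ _ hx hy => rw [smul_add, hx, hy]
      | smul c x _ hx => rw [smul_comm, hx]
    · refine smul_eq_self_of_coroot_eq_zero P w b fun i => ?_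
      rw [P.ker_rootForm_eq_dualAnnihilator] at hb
      obtain ⟨φ, hφ, rfl⟩ := hb
      have h0 : φ (P.coroot i) = 0 :=
        (Submodule.mem_dualAnnihilator φ).mp hφ _ (Submodule.subset_span ⟨i, rfl⟩)
      rw [← h0]
      exact LinearMap.congr_fun (P.toPerfPair.apply_symm_apply φ) (P.coroot i)
  apply Subtype.ext
  apply RootPairing.Equiv.weightHom_injective P
  rw [OneMemClass.coe_one, map_one]
  ext m
  exact key m

/-- The longest element `w₀` of `W`. -/
def longest : P.weylGroup := (Finite.exists_max (length P ρ)).choose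

theorem length_le_length_longest (w : P.weylGroup) : length P ρ w ≤ length P ρ (longest P ρ) :=
  (Finite.exists_max (length P ρ)).choose_spec w

open Classical in
/-- The top Schubert polynomial `S_{w₀} = |W|⁻¹ ∏_{α > 0} α`. -/
def topSchubert : SymmetricAlgebra 𝕜 M :=
  (Nat.card P.weylGroup : 𝕜)⁻¹ • ∏ i with IsPos P ρ i, rootPoly P i

/-- The Hiller Schubert polynomial `S_w = ∂_{w⁻¹ w₀} S_{w₀}`. -/
def schubert (w : P.weylGroup) : SymmetricAlgebra 𝕜 M :=
  divDiffElt P ρ (w⁻¹ * longest P ρ) (topSchubert P ρ)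

/-- `c` is a family of coefficients expressing `S_u S_v` in the `S_w`, modulo the ideal generated
by the invariants of positive degree. -/
def IsSchubertExpansion (u v : P.weylGroup) (c : P.weylGroup → 𝕜) : Prop :=
  Ideal.Quotient.mk (invariantIdeal P) (schubert P ρ u * schubert P ρ v) =
    ∑ᶠ w, c w • (Ideal.Quotient.mk (invariantIdeal P) (schubert P ρ w) : Coinvariant P)

open Classical in
/-- The Schubert structure constant `c_{u,v}^w`: the coefficient of `S_w` in the expansion of
`S_u S_v` in the coinvariant algebra. -/
def structureConst (u v w : P.weylGroup) : 𝕜 :=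
  if h : ∃ c, IsSchubertExpansion P ρ u v c then h.choose w else 0

end HillerSchubert

end

/-!
The proof is self-contained on the side of reflection groups and rests on the following ideas.

*Lengths.* The simple reflections generate `W` (`closure_simple`): walking from a generic point of
the chamber towards a point outside it, the first hyperplane that is met belongs to a facet
(`exists_simple_neg`). A simple reflection permutes the positive roots other than its own, so the
length of `w` is the number of positive roots that `w` makes negative (`length_eq_card`), and the
exchange condition and the properties of the longest element follow.

*Divided differences.* By the Leibniz rule, the operator `∂_{s₁} ⋯ ∂_{sₖ}` commutes with
multiplication by a linear form up to a twist and a sum over the subwords with one letter erased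
(`divDiffWord_ι_mul`). By induction this shows that the operator of a reduced word depends only on
its product and that the operator of any other word is zero (`divDiffWord_wellDefined`); hence
`∂_v ∂_w` is `∂_{vw}` or `0`, according to whether lengths add. That `∂_{w₀} S_{w₀} = 1` is seen by
expanding `∂_{w₀}` over the field of fractions of `𝕜[V]` as a combination of the elements of `W`
(`divDiffElt_longest_posProd`).

*The Schubert basis.* Let `ε` be the constant term. The linear forms `ε ∂_v` vanish on the ideal
generated by the invariants of positive degree, and `ε ∂_v S_w = δ_{v,w}`. Conversely, a homogeneous
`f` killed by all `ε ∂_v` lies in this ideal (`mem_invariantIdeal`): by induction the `∂_s f` do,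
so `f` is congruent to its average over `W`. Hence `c_{u,v}^w = ε ∂_w (S_u S_v)`, and this vanishes
for degree reasons unless `ℓ(w) = ℓ(u) + ℓ(v)`.

*Parabolic factorizations.* For `u ∈ W^J` and `s ∈ J` one has `us > u`, hence `∂_s S_u = 0`, and
`S_u` is `W_J`-invariant. As `ℓ(ux') = ℓ(u) + ℓ(x')`, it follows that
`∂_{ux'} (S_u S_x) = ∂_u (S_u ∂_{x'} S_x)`, which is `δ_{x',x}` when `ℓ(x') = ℓ(x)`.
-/

noncomputable section

namespace HillerSchubert

variable {ι 𝕜 M N : Type*} [Field 𝕜]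
  [AddCommGroup M] [Module 𝕜 M] [AddCommGroup N] [Module 𝕜 N]

/-! ### Roots and reflections -/

section Group

variable (P : RootPairing ι 𝕜 M N)

theorem refl_smul (i : ι) (m : M) : refl P i • m = m - P.coroot' i m • P.root i :=
  P.reflection_apply i m

theorem root_smul (w : P.weylGroup) (i : ι) : P.root (w • i) = w • P.root i :=
  (P.weylGroup_apply_root w i).symm

theorem weylGroup_ext {v w : P.weylGroup} (h : ∀ m : M, v • m = w • m) : v = w := by
  apply Subtype.ext
  apply RootPairing.Equiv.weightHom_injective P
  ext m
  exact h m

theorem smul_smul_comm (w : P.weylGroup) (c : 𝕜) (m : M) : w • c • m = c • w • m :=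
  smul_comm w c m

@[simp]
theorem refl_mul_self (i : ι) : refl P i * refl P i = 1 := by
  apply Subtype.ext
  change RootPairing.Equiv.reflection P i * RootPairing.Equiv.reflection P i = 1
  rw [mul_eq_one_iff_inv_eq, RootPairing.Equiv.reflection_inv]

@[simp]
theorem refl_inv (i : ι) : (refl P i)⁻¹ = refl P i :=
  inv_eq_of_mul_eq_one_left (refl_mul_self P i)

theorem coroot'_smul_smul (w : P.weylGroup) (i : ι) (m : M) :
    P.coroot' (w • i) (w • m) = P.coroot' i m := by
  obtain ⟨w, hw⟩ := w
  induction hw using RootPairing.weylGroup.induction generalizing i m with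
  | mem j =>
    change P.coroot' (P.reflectionPerm j i) (P.reflection j m) = _
    rw [P.coroot'_reflection, P.reflectionPerm_self]
  | one =>
    change P.coroot' ((1 : P.weylGroup) • i) ((1 : P.weylGroup) • m) = _
    rw [one_smul, one_smul]
  | mul x y hx hy h1 h2 =>
    rw [← Submonoid.mk_mul_mk _ _ _ hx hy, mul_smul, mul_smul]
    exact (h1 _ _).trans (h2 _ _)

theorem coroot'_smul (w : P.weylGroup) (i : ι) (m : M) :
    P.coroot' i (w • m) = P.coroot' (w⁻¹ • i) m := by
  rw [← coroot'_smul_smul P w (w⁻¹ • i), smul_inv_smul]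

/-- The reflection in the root `wα` is `w s_α w⁻¹`. -/
theorem refl_smul_index (w : P.weylGroup) (i : ι) : refl P (w • i) = w * refl P i * w⁻¹ := by
  refine weylGroup_ext P fun m => ?_
  rw [mul_smul, mul_smul, refl_smul, refl_smul, smul_sub, smul_inv_smul, smul_smul_comm,
    root_smul, coroot'_smul, inv_inv]

/-- The index of the root opposite to the one with index `i`. -/
def neg (i : ι) : ι := refl P i • i

@[simp]
theorem root_neg (i : ι) : P.root (neg P i) = -P.root i := by
  rw [neg, root_smul]
  exact P.reflection_apply_self i

theorem smul_neg_index (w : P.weylGroup) (i : ι) : w • neg P i = neg P (w • i) := by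
  apply P.root.injective
  rw [root_smul, root_neg, root_neg, root_smul, smul_neg]

@[simp]
theorem neg_neg_index (i : ι) : neg P (neg P i) = i := by
  apply P.root.injective
  rw [root_neg, root_neg, neg_neg]

@[simp]
theorem root'_neg (i : ι) (v : N) : P.root' (neg P i) v = -P.root' i v := by
  simp [RootPairing.root']

theorem refl_neg (i : ι) : refl P (neg P i) = refl P i := by
  rw [neg, refl_smul_index]
  simp

theorem root'_coreflection (i j : ι) (v : N) :
    P.root' j (P.coreflection i v) = P.root' (refl P i • j) v := by
  have : P.root (refl P i • j) = P.reflection i (P.root j) := root_smul P _ _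
  simp only [RootPairing.root', this, P.coreflection_apply, P.reflection_apply]
  simp [mul_comm]

/-- The group `W` also acts on `V`: there is a point `v = w⁻¹ p`, on which a root `α` takes the value
of `w α` on `p`. -/
theorem exists_transpose (w : P.weylGroup) (p : N) :
    ∃ v : N, ∀ k, P.root' k v = P.root' (w • k) p := by
  obtain ⟨w, hw⟩ := w
  induction hw using RootPairing.weylGroup.induction generalizing p with
  | mem j => exact ⟨P.coreflection j p, fun k => root'_coreflection P j k p⟩
  | one => exact ⟨p, fun k => rfl⟩
  | mul x y hx hy h1 h2 =>
    obtain ⟨v₁, hv₁⟩ := h1 p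
    obtain ⟨v₂, hv₂⟩ := h2 v₁
    refine ⟨v₂, fun k => (hv₂ k).trans ((hv₁ _).trans ?_)⟩
    rw [← Submonoid.mk_mul_mk _ _ _ hx hy, mul_smul]

theorem linearIndependent_root [P.IsReduced] {i j : ι} (h : i ≠ j) (h' : i ≠ neg P j) {a b : 𝕜}
    (hab : a • P.root i + b • P.root j = 0) : a = 0 ∧ b = 0 := by
  have := RootPairing.IsReduced.linearIndependent P h
    fun h1 => h' (P.root.injective (by rw [h1, root_neg]))
  exact LinearIndependent.pair_iff.mp this a b hab

end Group

section Order

variable [LinearOrder 𝕜] [IsStrictOrderedRing 𝕜] (P : RootPairing ι 𝕜 M N) {ρ : N}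

theorem IsRegular.isPos_neg_iff (hρ : IsRegular P ρ) {i : ι} :
    IsPos P ρ (neg P i) ↔ ¬ IsPos P ρ i := by
  have := hρ i
  simp only [IsPos, root'_neg, Left.neg_pos_iff, not_lt]
  exact ⟨le_of_lt, fun h => lt_of_le_of_ne h this⟩

/-- A simple reflection permutes the positive roots other than the simple root itself. -/
theorem isPos_refl_smul (hρ : IsRegular P ρ) {i j : ι} (hi : i ∈ simple P ρ) (hj : IsPos P ρ j)
    (hji : j ≠ i) : IsPos P ρ (refl P i • j) := by
  obtain ⟨hi0, v, hv, hv'⟩ := hi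
  have h1 : 0 < P.root' (refl P i • j) v := by
    have h2 : P.root' (refl P i • j) v = P.root' j v := by
      have : P.root (refl P i • j) = P.reflection i (P.root j) := root_smul P _ _
      simp only [RootPairing.root', this, P.reflection_apply] at hv ⊢
      simp [hv]
    rw [h2]
    exact hv' j hj hji
  by_contra h
  rw [← IsRegular.isPos_neg_iff P hρ] at h
  by_cases h3 : neg P (refl P i • j) = i
  · rw [← h3, root'_neg] at hv
    linarith
  · have := hv' _ h h3
    rw [root'_neg] at this
    linarith

theorem not_isPos_refl_smul_self (hρ : IsRegular P ρ) {i : ι} (hi : i ∈ simple P ρ) :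
    ¬ IsPos P ρ (refl P i • i) := by
  rw [← IsRegular.isPos_neg_iff P hρ]
  change IsPos P ρ (neg P (neg P i))
  rw [neg_neg_index]
  exact hi.1

theorem isPos_refl_smul_iff (hρ : IsRegular P ρ) {i j : ι} (hi : i ∈ simple P ρ) (hji : j ≠ i)
    (hji' : j ≠ neg P i) : IsPos P ρ (refl P i • j) ↔ IsPos P ρ j := by
  refine ⟨fun h => ?_, fun h => isPos_refl_smul P hρ hi h hji⟩
  have := isPos_refl_smul P hρ hi h fun h => hji' ?_
  · rwa [← mul_smul, refl_mul_self, one_smul] at this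
  · rw [neg, ← h, ← mul_smul, h, refl_mul_self, one_smul]

/-! ### The simple reflections generate the group -/

section Generation

variable [Fintype ι]

open Filter Topology in
/-- A point of the chamber of `ρ` at which finitely many given nonzero linear forms do not
vanish. -/
theorem exists_generic {κ : Type*} [Finite κ] (f : κ → Module.Dual 𝕜 N) (hf : ∀ k, f k ≠ 0)
    (ρ : N) :
    ∃ ρ' : N, (∀ i, IsPos P ρ i → IsPos P ρ' i) ∧ ∀ k, f k ρ' ≠ 0 := by
  obtain ⟨η, hη⟩ := Module.Dual.exists_forall_ne_zero_of_forall_exists f fun k => by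
    by_contra! h
    exact hf k (LinearMap.ext h)
  let _ : TopologicalSpace 𝕜 := Preorder.topology 𝕜
  have : OrderTopology 𝕜 := ⟨rfl⟩
  have hcont : ∀ a b : 𝕜, Tendsto (fun ε : 𝕜 => a + ε * b) (𝓝[>] 0) (𝓝 a) := fun a b => by
    have : Continuous fun ε : 𝕜 => a + ε * b := by fun_prop
    have h := this.tendsto 0
    simp only [zero_mul, add_zero] at h
    exact h.mono_left nhdsWithin_le_nhds
  have h1 : ∀ᶠ ε : 𝕜 in 𝓝[>] 0, ∀ i, IsPos P ρ i → IsPos P (ρ + ε • η) i := by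
    rw [eventually_all]
    intro i
    by_cases h : IsPos P ρ i
    · filter_upwards [(hcont (P.root' i ρ) (P.root' i η)).eventually (lt_mem_nhds h)] with ε hε _
      simpa [IsPos] using hε
    · simp [h]
  have h2 : ∀ᶠ ε : 𝕜 in 𝓝[>] 0, ∀ k, f k (ρ + ε • η) ≠ 0 := by
    rw [eventually_all]
    intro k
    by_cases h : f k ρ = 0
    · filter_upwards [self_mem_nhdsWithin] with ε hε
      simpa [h, hη k] using hε.ne'
    · filter_upwards [(hcont (f k ρ) (f k η)).eventually (isOpen_ne.mem_nhds h)] with ε hε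
      simpa using hε
  obtain ⟨ε, h1, h2⟩ := (h1.and h2).exists
  exact ⟨_, h1, h2⟩

variable [P.IsReduced]

/-- A point outside the closed chamber is on the negative side of one of the walls of the chamber.
This is seen by walking towards it from a generic point of the chamber: the first hyperplane that
is met belongs to a facet. -/
theorem exists_simple_neg (hρ : IsRegular P ρ) (p : N) {j : ι} (hj : IsPos P ρ j)
    (hjp : P.root' j p < 0) : ∃ i ∈ simple P ρ, P.root' i p < 0 := by
  -- `ρ'` avoids the coincidence of the parameters at which the path `ρ' + t p` meets two different
  -- hyperplanes
  let κ := {ij : ι × ι // IsPos P ρ ij.1 ∧ IsPos P ρ ij.2 ∧ ij.1 ≠ ij.2 ∧ P.root' ij.1 p < 0}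
  let f : κ → Module.Dual 𝕜 N := fun k =>
    P.root' k.1.1 p • P.root' k.1.2 - P.root' k.1.2 p • P.root' k.1.1
  have hf : ∀ k, f k ≠ 0 := by
    rintro ⟨⟨a, b⟩, ha, hb, hab, hap⟩ h0
    have hab' : b ≠ neg P a := by
      rintro rfl
      exact (IsRegular.isPos_neg_iff P hρ).1 hb ha
    have : P.toLinearMap (P.root' a p • P.root b + (-P.root' b p) • P.root a) = 0 := by
      rw [← h0]
      ext n
      simp [f, RootPairing.root', sub_eq_add_neg]
    have := P.toPerfPair.injective (this.trans (map_zero _).symm)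
    exact hap.ne (linearIndependent_root P hab.symm hab' this).1
  obtain ⟨ρ', h1, h2⟩ := exists_generic P f hf ρ
  classical
  obtain ⟨i, hi, hmin⟩ := (Finset.univ.filter fun i => IsPos P ρ i ∧ P.root' i p < 0).exists_min_image
    (fun i => P.root' i ρ' / -P.root' i p) ⟨j, by simp [hj, hjp]⟩
  simp only [Finset.mem_filter, Finset.mem_univ, true_and] at hi hmin
  have hip : 0 < -P.root' i p := by linarith [hi.2]
  refine ⟨i, ⟨hi.1, ρ' + (P.root' i ρ' / -P.root' i p) • p, ?_, fun k hk hki => ?_⟩, hi.2⟩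
  · simp only [map_add, map_smul, smul_eq_mul]
    have := neg_ne_zero.1 hip.ne'
    field_simp
    ring
  · simp only [map_add, map_smul, smul_eq_mul]
    have hρi : 0 < P.root' i ρ' := h1 i hi.1
    have hρk : 0 < P.root' k ρ' := h1 k hk
    have hr : 0 < P.root' i ρ' / -P.root' i p := div_pos hρi hip
    rcases le_or_gt 0 (P.root' k p) with hkp | hkp
    · nlinarith
    · have hkp' : 0 < -P.root' k p := by linarith
      have h3 := hmin k ⟨hk, hkp⟩
      have h4 : P.root' i ρ' / -P.root' i p ≠ P.root' k ρ' / -P.root' k p := by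
        intro h
        refine h2 ⟨(i, k), hi.1, hk, hki.symm, hi.2⟩ ?_
        rw [div_eq_div_iff hip.ne' hkp'.ne'] at h
        simp only [f, LinearMap.sub_apply, LinearMap.smul_apply, smul_eq_mul]
        linarith
      have h5 := lt_of_le_of_ne h3 h4
      rw [lt_div_iff₀ hkp'] at h5
      linarith

/-- Products of simple reflections move any point into the closed chamber: the reflection in a wall
that the point is on the wrong side of decreases the number of positive roots that are negative
there. -/
theorem exists_closure_smul_nonneg (hρ : IsRegular P ρ) (p : N) :
    ∃ w ∈ Subgroup.closure (refl P '' simple P ρ), ∀ j, IsPos P ρ j → 0 ≤ P.root' (w • j) p := by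
  classical
  induction h : (Finset.univ.filter fun i => IsPos P ρ i ∧ P.root' i p < 0).card
    using Nat.strong_induction_on generalizing p with
  | _ n ih =>
  by_cases hp : ∃ j, IsPos P ρ j ∧ P.root' j p < 0
  · obtain ⟨j, hj, hjp⟩ := hp
    obtain ⟨i, hi, hip⟩ := exists_simple_neg P hρ p hj hjp
    suffices hlt : (Finset.univ.filter fun k =>
        IsPos P ρ k ∧ P.root' k (P.coreflection i p) < 0).card < n by
      obtain ⟨w, hw, hw'⟩ := ih _ hlt (P.coreflection i p) rfl
      refine ⟨refl P i * w, mul_mem (Subgroup.subset_closure ⟨i, hi, rfl⟩) hw, fun j hj => ?_⟩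
      rw [mul_smul, ← root'_coreflection]
      exact hw' j hj
    · rw [← h, ← Finset.card_map (MulAction.toPerm (refl P i)).toEmbedding]
      apply Finset.card_lt_card
      rw [Finset.ssubset_iff_of_subset]
      · refine ⟨i, by simp [hi.1, hip], ?_⟩
        simp only [Finset.mem_map, Finset.mem_filter, Finset.mem_univ, true_and, not_exists, not_and,
          Equiv.coe_toEmbedding, MulAction.toPerm_apply]
        rintro k ⟨hk, -⟩ hki
        apply not_isPos_refl_smul_self P hρ hi
        rw [← hki, ← mul_smul, hki, refl_mul_self, one_smul]
        exact hk
      · intro k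
        simp only [Finset.mem_map, Finset.mem_filter, Finset.mem_univ, true_and,
          Equiv.coe_toEmbedding, MulAction.toPerm_apply]
        rintro ⟨k, ⟨hk, hk'⟩, rfl⟩
        rw [root'_coreflection] at hk'
        refine ⟨isPos_refl_smul P hρ hi hk ?_, hk'⟩
        rintro rfl
        change P.root' (neg P k) p < 0 at hk'
        rw [root'_neg] at hk'
        linarith
  · push Not at hp
    exact ⟨1, one_mem _, fun j hj => by simpa using hp j hj⟩

/-- Every root is conjugate to a simple one, under the group generated by simple reflections. -/
theorem exists_smul_mem_simple (hρ : IsRegular P ρ) (i : ι) :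
    ∃ w ∈ Subgroup.closure (refl P '' simple P ρ), ∃ j ∈ simple P ρ, w • j = i ∨ w • j = neg P i := by
  -- `p` lies on the hyperplane of `i` and on no other one
  obtain ⟨p, hp0, hp⟩ : ∃ p, P.root' i p = 0 ∧ ∀ j, j ≠ i → j ≠ neg P i → P.root' j p ≠ 0 := by
    suffices h : ∀ j : {j // j ≠ i ∧ j ≠ neg P i}, ∃ x ∈ LinearMap.ker (P.root' i),
        P.root' j.1 x ≠ 0 by
      obtain ⟨p, hp0, hp⟩ := Module.Dual.exists_forall_mem_ne_zero_of_forall_exists _ _ h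
      exact ⟨p, hp0, fun j h h' => hp ⟨j, h, h'⟩⟩
    · rintro ⟨j, hj, hj'⟩
      have h0 : P.toLinearMap ((2 : 𝕜) • P.root j + (-P.pairing j i) • P.root i) ≠ 0 := by
        intro h
        have := P.toPerfPair.injective (h.trans (map_zero _).symm)
        exact two_ne_zero (linearIndependent_root P hj hj' this).1
      obtain ⟨x, hx⟩ := not_forall.1 fun h => h0 (LinearMap.ext h)
      refine ⟨(2 : 𝕜) • x - P.root' i x • P.coroot i, ?_, ?_⟩
      · simp [mul_comm]
      · change ¬ _ = (0 : 𝕜) at hx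
        intro h0
        apply hx
        rw [← h0]
        simp [RootPairing.root']
        ring
  obtain ⟨w, hw, hw'⟩ := exists_closure_smul_nonneg P hρ p
  refine ⟨w, hw, ?_⟩
  obtain ⟨j, hj, hj'⟩ : ∃ j, IsPos P ρ j ∧ (w • j = i ∨ w • j = neg P i) := by
    by_cases h : IsPos P ρ (w⁻¹ • i)
    · exact ⟨_, h, by simp⟩
    · exact ⟨neg P (w⁻¹ • i), (IsRegular.isPos_neg_iff P hρ).2 h, by simp [smul_neg_index]⟩
  refine ⟨j, ⟨hj, ?_⟩, hj'⟩
  -- `v = w⁻¹ p` lies on the closed chamber, on the hyperplane of `j` only, so `j` is simple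
  obtain ⟨v, hv⟩ := exists_transpose P w p
  refine ⟨v, ?_, fun k hk hkj => ?_⟩
  · rw [hv]
    rcases hj' with h | h <;> simp [h, hp0]
  · rw [hv]
    refine lt_of_le_of_ne (hw' k hk) (hp _ ?_ ?_).symm
    · intro h
      rcases hj' with h' | h'
      · exact hkj (smul_left_cancel w (h.trans h'.symm))
      · apply (IsRegular.isPos_neg_iff P hρ).1 _ hj
        convert hk
        apply smul_left_cancel w
        rw [smul_neg_index, h', h, neg_neg_index]
    · intro h
      rcases hj' with h' | h'
      · apply (IsRegular.isPos_neg_iff P hρ).1 _ hj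
        convert hk
        apply smul_left_cancel w
        rw [smul_neg_index, h', h]
      · exact hkj (smul_left_cancel w (h.trans h'.symm))

/-- The simple reflections generate `W`. -/
theorem closure_simple (hρ : IsRegular P ρ) :
    Subgroup.closure (refl P '' simple P ρ) = ⊤ := by
  have key : ∀ i, refl P i ∈ Subgroup.closure (refl P '' simple P ρ) := by
    intro i
    obtain ⟨w, hw, j, hj, h⟩ := exists_smul_mem_simple P hρ i
    have h' : refl P i = w * refl P j * w⁻¹ := by
      rw [← refl_smul_index]
      rcases h with h | h <;> simp [h, refl_neg]
    rw [h']
    exact mul_mem (mul_mem hw (Subgroup.subset_closure ⟨j, hj, rfl⟩)) (inv_mem hw)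
  rw [eq_top_iff]
  rintro ⟨w, hw⟩ -
  induction hw using RootPairing.weylGroup.induction with
  | mem j => exact key j
  | one => exact one_mem _
  | mul x y hx hy h1 h2 => exact mul_mem h1 h2

end Generation

end Order

/-! ### Length and inversions -/

section Length

variable [LinearOrder 𝕜] (P : RootPairing ι 𝕜 M N) {ρ : N}

@[simp]
theorem wordProd_nil : wordProd P ρ [] = 1 := rfl

@[simp]
theorem wordProd_cons (s : simple P ρ) (l : List (simple P ρ)) :
    wordProd P ρ (s :: l) = refl P s * wordProd P ρ l := by
  simp [wordProd]

@[simp]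
theorem wordProd_append (l l' : List (simple P ρ)) :
    wordProd P ρ (l ++ l') = wordProd P ρ l * wordProd P ρ l' := by
  simp [wordProd]

theorem wordProd_reverse (l : List (simple P ρ)) :
    wordProd P ρ l.reverse = (wordProd P ρ l)⁻¹ := by
  induction l with
  | nil => simp
  | cons s l ih => simp [ih]

theorem length_wordProd_le (l : List (simple P ρ)) : length P ρ (wordProd P ρ l) ≤ l.length :=
  Nat.sInf_le ⟨l, rfl, rfl⟩

theorem length_one : length P ρ (1 : P.weylGroup) = 0 :=
  Nat.le_zero.1 (length_wordProd_le P [])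

/-- The words obtained from `l = s₁ ⋯ sₖ` by erasing one letter `s_j`. Each one is paired with the
root `sₖ ⋯ s_{j+1} α_{s_j}`, the reflection in which is the difference of the two products. -/
def erasures : List (simple P ρ) → List (ι × List (simple P ρ))
  | [] => []
  | s :: l => ((wordProd P ρ l)⁻¹ • (s : ι), l) :: (erasures l).map fun p => (p.1, s :: p.2)

/-- The roots `sₖ ⋯ s_{j+1} α_{s_j}` of a word `s₁ ⋯ sₖ`. -/
def wordRoots (l : List (simple P ρ)) : List ι := (erasures P l).map Prod.fst

@[simp]
theorem wordRoots_nil : wordRoots P (ρ := ρ) [] = [] := rfl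

@[simp]
theorem wordRoots_cons (s : simple P ρ) (l : List (simple P ρ)) :
    wordRoots P (s :: l) = (wordProd P ρ l)⁻¹ • (s : ι) :: wordRoots P l := by
  simp [wordRoots, erasures]

theorem wordRoots_concat (l : List (simple P ρ)) (s : simple P ρ) :
    wordRoots P (l ++ [s]) = (wordRoots P l).map (refl P s • ·) ++ [(s : ι)] := by
  induction l with
  | nil => simp
  | cons t l ih => simp [ih, mul_smul]

theorem mem_erasures {l : List (simple P ρ)} {p : ι × List (simple P ρ)} (hp : p ∈ erasures P l) :
    p.2.length + 1 = l.length ∧ wordProd P ρ p.2 = wordProd P ρ l * refl P p.1 ∧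
      ∀ s ∈ p.2, s ∈ l := by
  induction l generalizing p with
  | nil => simp [erasures] at hp
  | cons s l ih =>
    rw [erasures, List.mem_cons, List.mem_map] at hp
    rcases hp with rfl | ⟨p, hp, rfl⟩
    · refine ⟨by simp, ?_, fun t ht => List.mem_cons_of_mem _ ht⟩
      rw [refl_smul_index, wordProd_cons, inv_inv]
      have := refl_mul_self P (s : ι)
      simp only [mul_assoc, mul_inv_cancel_left]
      rw [← mul_assoc, this, one_mul]
    · obtain ⟨h1, h2, h3⟩ := ih hp
      refine ⟨by simp [h1], by simp [h2, mul_assoc], fun t ht => ?_⟩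
      rw [List.mem_cons] at ht ⊢
      exact ht.imp id (h3 t)

theorem wordProd_mem_parabolic {J : Set ι} {l : List (simple P ρ)} (hl : ∀ s ∈ l, (s : ι) ∈ J) :
    wordProd P ρ l ∈ parabolic P J := by
  induction l with
  | nil => exact one_mem _
  | cons s l ih =>
    rw [wordProd_cons]
    exact mul_mem (Subgroup.subset_closure ⟨s, hl s List.mem_cons_self, rfl⟩)
      (ih fun t ht => hl t (List.mem_cons_of_mem _ ht))

variable [Fintype ι]

open Classical in
/-- The inversions of `w`: the positive roots that `w` makes negative. -/
def inversions (ρ : N) (w : P.weylGroup) : Finset ι :=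
  Finset.univ.filter fun i => IsPos P ρ i ∧ ¬ IsPos P ρ (w • i)

theorem mem_inversions {w : P.weylGroup} {i : ι} :
    i ∈ inversions P ρ w ↔ IsPos P ρ i ∧ ¬ IsPos P ρ (w • i) := by
  simp [inversions]

variable [IsStrictOrderedRing 𝕜]

theorem mem_inversions_refl_mul (hρ : IsRegular P ρ) {s : ι} (hs : s ∈ simple P ρ)
    {w : P.weylGroup} (hw : IsPos P ρ (w⁻¹ • s)) (i : ι) :
    i ∈ inversions P ρ (refl P s * w) ↔ i = w⁻¹ • s ∨ i ∈ inversions P ρ w := by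
  by_cases hi : i = w⁻¹ • s
  · subst hi
    simpa [mem_inversions, mul_smul, hw] using not_isPos_refl_smul_self P hρ hs
  · simp only [mem_inversions, mul_smul, hi, false_or]
    refine and_congr_right fun h => ?_
    rw [isPos_refl_smul_iff P hρ hs]
    · rintro h'
      exact hi (by rw [← h', inv_smul_smul])
    · intro h'
      rw [eq_comm, ← inv_smul_eq_iff, smul_neg_index] at h'
      rw [← h', IsRegular.isPos_neg_iff P hρ] at h
      exact h hw

theorem card_inversions_refl_mul (hρ : IsRegular P ρ) {s : ι} (hs : s ∈ simple P ρ)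
    {w : P.weylGroup} (hw : IsPos P ρ (w⁻¹ • s)) :
    (inversions P ρ (refl P s * w)).card = (inversions P ρ w).card + 1 := by
  classical
  have : inversions P ρ (refl P s * w) = insert (w⁻¹ • s) (inversions P ρ w) := by
    ext i
    rw [mem_inversions_refl_mul P hρ hs hw, Finset.mem_insert]
  rw [this, Finset.card_insert_of_notMem]
  rw [mem_inversions, smul_inv_smul]
  exact fun h => h.2 hs.1

variable [P.IsReduced]

theorem exists_isReducedWord (hρ : IsRegular P ρ) (w : P.weylGroup) :
    ∃ l, IsReducedWord P ρ l w := by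
  have hne : {n | ∃ l, wordProd P ρ l = w ∧ l.length = n}.Nonempty := by
    have hw : w ∈ Subgroup.closure (refl P '' simple P ρ) := by
      rw [closure_simple P hρ]; trivial
    induction hw using Subgroup.closure_induction with
    | mem x hx =>
      obtain ⟨i, hi, rfl⟩ := hx
      exact ⟨_, [⟨i, hi⟩], by simp, rfl⟩
    | one => exact ⟨_, [], rfl, rfl⟩
    | mul x y _ _ hx hy =>
      obtain ⟨_, l, rfl, -⟩ := hx
      obtain ⟨_, l', rfl, -⟩ := hy
      exact ⟨_, l ++ l', by simp, rfl⟩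
    | inv x _ hx =>
      obtain ⟨_, l, rfl, -⟩ := hx
      exact ⟨_, l.reverse, wordProd_reverse P l, rfl⟩
  obtain ⟨l, h1, h2⟩ := Nat.sInf_mem hne
  exact ⟨l, h1, h2⟩

theorem isReducedWord_reducedWord (hρ : IsRegular P ρ) (w : P.weylGroup) :
    IsReducedWord P ρ (reducedWord P ρ w) w := by
  have h := exists_isReducedWord P hρ w
  rw [reducedWord, dif_pos h]
  exact h.choose_spec

theorem length_refl_mul_le (hρ : IsRegular P ρ) (s : simple P ρ) (w : P.weylGroup) :
    length P ρ (refl P s * w) ≤ length P ρ w + 1 := by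
  obtain ⟨l, rfl, hl⟩ := exists_isReducedWord P hρ w
  rw [← hl, ← wordProd_cons]
  exact length_wordProd_le P (s :: l)

theorem length_tail (hρ : IsRegular P ρ) {s : simple P ρ} {l : List (simple P ρ)}
    (h : length P ρ (wordProd P ρ (s :: l)) = (s :: l).length) :
    length P ρ (wordProd P ρ l) = l.length := by
  have h1 := length_refl_mul_le P hρ s (wordProd P ρ l)
  have h2 := length_wordProd_le P l
  rw [wordProd_cons, List.length_cons] at h
  omega

/-- The roots of a reduced word are the inversions of its product, each occurring once. The
exchange condition is part of the proof: were the new root negative, its opposite would be an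
inversion of the tail, and erasing the corresponding letter would shorten the word. -/
theorem wordRoots_of_reduced (hρ : IsRegular P ρ) {l : List (simple P ρ)}
    (hl : length P ρ (wordProd P ρ l) = l.length) :
    (wordRoots P l).Nodup ∧ ∀ i, i ∈ wordRoots P l ↔ i ∈ inversions P ρ (wordProd P ρ l) := by
  induction l with
  | nil => simp [mem_inversions]
  | cons s l ih =>
    have hl' := length_tail P hρ hl
    obtain ⟨h1, h2⟩ := ih hl'
    have hpos : IsPos P ρ ((wordProd P ρ l)⁻¹ • (s : ι)) := by
      by_contra hneg
      have h3 : neg P ((wordProd P ρ l)⁻¹ • (s : ι)) ∈ wordRoots P l := by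
        rw [h2, mem_inversions, IsRegular.isPos_neg_iff P hρ, smul_neg_index, smul_inv_smul,
          IsRegular.isPos_neg_iff P hρ]
        exact ⟨hneg, not_not_intro s.2.1⟩
      rw [wordRoots, List.mem_map] at h3
      obtain ⟨p, hp, hp'⟩ := h3
      obtain ⟨h4, h5, -⟩ := mem_erasures P hp
      have h6 := length_wordProd_le P p.2
      rw [h5, hp', refl_neg, refl_smul_index, inv_inv] at h6
      simp only [mul_assoc, mul_inv_cancel_left] at h6
      rw [wordProd_cons, List.length_cons] at hl
      omega
    rw [wordRoots_cons, wordProd_cons, List.nodup_cons]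
    refine ⟨⟨?_, h1⟩, fun i => ?_⟩
    · rw [h2, mem_inversions, smul_inv_smul]
      exact fun h => h.2 s.2.1
    · rw [mem_inversions_refl_mul P hρ s.2 hpos, List.mem_cons, h2]

theorem length_eq_card (hρ : IsRegular P ρ) (w : P.weylGroup) :
    length P ρ w = (inversions P ρ w).card := by
  classical
  obtain ⟨l, rfl, hl⟩ := exists_isReducedWord P hρ w
  obtain ⟨h1, h2⟩ := wordRoots_of_reduced P hρ hl.symm
  have : inversions P ρ (wordProd P ρ l) = (wordRoots P l).toFinset := by
    ext i
    rw [← h2, List.mem_toFinset]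
  rw [this, List.toFinset_card_of_nodup h1, ← hl]
  clear * -
  induction l with
  | nil => rfl
  | cons s l ih => simp [ih]

theorem length_refl_mul (hρ : IsRegular P ρ) {s : ι} (hs : s ∈ simple P ρ) {w : P.weylGroup}
    (hw : IsPos P ρ (w⁻¹ • s)) : length P ρ (refl P s * w) = length P ρ w + 1 := by
  rw [length_eq_card P hρ, length_eq_card P hρ, card_inversions_refl_mul P hρ hs hw]

theorem length_refl (hρ : IsRegular P ρ) {s : ι} (hs : s ∈ simple P ρ) :
    length P ρ (refl P s) = 1 := by
  have := length_refl_mul P hρ hs (w := 1) (by simpa using hs.1)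
  rwa [mul_one, length_one] at this

theorem length_refl_mul_of_not_isPos (hρ : IsRegular P ρ) {s : ι} (hs : s ∈ simple P ρ)
    {w : P.weylGroup} (hw : ¬ IsPos P ρ (w⁻¹ • s)) :
    length P ρ (refl P s * w) + 1 = length P ρ w := by
  have := length_refl_mul P hρ hs (w := refl P s * w) (by
    rw [mul_inv_rev, mul_smul, refl_inv]
    change IsPos P ρ (w⁻¹ • neg P s)
    rwa [smul_neg_index, IsRegular.isPos_neg_iff P hρ])
  rw [← this, ← mul_assoc, refl_mul_self, one_mul]

theorem length_inv (hρ : IsRegular P ρ) (w : P.weylGroup) : length P ρ w⁻¹ = length P ρ w := by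
  have key : ∀ w : P.weylGroup, length P ρ w⁻¹ ≤ length P ρ w := fun w => by
    obtain ⟨l, rfl, hl⟩ := exists_isReducedWord P hρ w
    rw [← hl, ← wordProd_reverse, ← l.length_reverse]
    exact length_wordProd_le P _
  exact (key w).antisymm (by simpa using key w⁻¹)

theorem length_mul_refl (hρ : IsRegular P ρ) {s : ι} (hs : s ∈ simple P ρ) {w : P.weylGroup}
    (hw : IsPos P ρ (w • s)) : length P ρ (w * refl P s) = length P ρ w + 1 := by
  rw [← length_inv P hρ, mul_inv_rev, refl_inv, ← length_inv P hρ w]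
  exact length_refl_mul P hρ hs (by rwa [inv_inv])

theorem length_mul_refl_of_not_isPos (hρ : IsRegular P ρ) {s : ι} (hs : s ∈ simple P ρ)
    {w : P.weylGroup} (hw : ¬ IsPos P ρ (w • s)) :
    length P ρ (w * refl P s) + 1 = length P ρ w := by
  rw [← length_inv P hρ, mul_inv_rev, refl_inv, ← length_inv P hρ w]
  exact length_refl_mul_of_not_isPos P hρ hs (by rwa [inv_inv])

/-- The strong exchange condition: if `w` makes the positive root `α` negative, then `w s_α` is
obtained by erasing a letter of a given reduced word of `w`. -/
theorem exists_erasure (hρ : IsRegular P ρ) {l : List (simple P ρ)}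
    (hl : length P ρ (wordProd P ρ l) = l.length) {i : ι} (hi : IsPos P ρ i)
    (hi' : ¬ IsPos P ρ (wordProd P ρ l • i)) :
    ∃ l' : List (simple P ρ), l'.length + 1 = l.length ∧
      wordProd P ρ l' = wordProd P ρ l * refl P i ∧ ∀ s ∈ l', s ∈ l := by
  have h := ((wordRoots_of_reduced P hρ hl).2 i).2 ((mem_inversions P).2 ⟨hi, hi'⟩)
  rw [wordRoots, List.mem_map] at h
  obtain ⟨p, hp, rfl⟩ := h
  exact ⟨p.2, mem_erasures P hp⟩

theorem length_mul_refl_lt (hρ : IsRegular P ρ) {w : P.weylGroup} {i : ι} (hi : IsPos P ρ i)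
    (hi' : ¬ IsPos P ρ (w • i)) : length P ρ (w * refl P i) < length P ρ w := by
  obtain ⟨l, rfl, hl⟩ := exists_isReducedWord P hρ w
  obtain ⟨l', h1, h2, -⟩ := exists_erasure P hρ hl.symm hi hi'
  rw [← h2, ← hl]
  have := length_wordProd_le P l'
  omega

theorem eq_one_of_length_eq_zero (hρ : IsRegular P ρ) {w : P.weylGroup} (hw : length P ρ w = 0) :
    w = 1 := by
  obtain ⟨l, rfl, hl⟩ := exists_isReducedWord P hρ w
  rw [hw, List.length_eq_zero_iff] at hl
  rw [hl, wordProd_nil]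

/-! ### The longest element -/

/-- As `s w₀` is not longer than `w₀`, the inverse of `w₀` makes every simple root negative; so
`-w₀ρ` lies on the positive side of every wall, hence in the chamber of `ρ`. -/
theorem not_isPos_longest_inv_smul (hρ : IsRegular P ρ) {i : ι} (hi : IsPos P ρ i) :
    ¬ IsPos P ρ ((longest P ρ)⁻¹ • i) := by
  obtain ⟨v, hv⟩ := exists_transpose P (longest P ρ)⁻¹ ρ
  intro h
  obtain ⟨s, hs, hsv⟩ := exists_simple_neg P hρ (-v) hi (by rw [map_neg, hv]; exact neg_neg_of_pos h)
  rw [map_neg, hv, neg_lt_zero] at hsv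
  have := length_refl_mul P hρ hs hsv
  have := length_le_length_longest P ρ (refl P s * longest P ρ)
  omega

theorem isPos_longest_smul_iff (hρ : IsRegular P ρ) {i : ι} :
    IsPos P ρ (longest P ρ • i) ↔ ¬ IsPos P ρ i := by
  have key : ∀ i, IsPos P ρ (longest P ρ • i) → ¬ IsPos P ρ i := fun i h => by
    simpa using not_isPos_longest_inv_smul P hρ h
  refine ⟨key i, fun h => ?_⟩
  by_contra h'
  refine key (neg P i) ?_ ((IsRegular.isPos_neg_iff P hρ).2 h)
  rwa [smul_neg_index, IsRegular.isPos_neg_iff P hρ]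

open Classical in
theorem inversions_longest (hρ : IsRegular P ρ) :
    inversions P ρ (longest P ρ) = Finset.univ.filter (IsPos P ρ) := by
  ext i
  simp [mem_inversions, isPos_longest_smul_iff P hρ]

open Classical in
theorem length_mul_longest (hρ : IsRegular P ρ) (w : P.weylGroup) :
    length P ρ (w * longest P ρ) + length P ρ w = length P ρ (longest P ρ) := by
  -- `i ↦ -w₀ i` matches the inversions of `w w₀` with the positive roots that `w` keeps positive
  have h1 : (inversions P ρ (w * longest P ρ)).card =
      ((Finset.univ.filter (IsPos P ρ)).filter fun i => IsPos P ρ (w • i)).card := by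
    refine Finset.card_bij' (fun i _ => neg P (longest P ρ • i))
      (fun i _ => neg P ((longest P ρ)⁻¹ • i)) ?_ ?_ ?_ ?_
    · intro i hi
      rw [mem_inversions, mul_smul] at hi
      simp only [Finset.mem_filter, Finset.mem_univ, true_and, smul_neg_index,
        IsRegular.isPos_neg_iff P hρ, isPos_longest_smul_iff P hρ]
      exact ⟨not_not_intro hi.1, hi.2⟩
    · intro i hi
      simp only [Finset.mem_filter, Finset.mem_univ, true_and] at hi
      simp only [mem_inversions, smul_neg_index, mul_smul, smul_inv_smul,
        IsRegular.isPos_neg_iff P hρ]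
      exact ⟨not_isPos_longest_inv_smul P hρ hi.1, not_not_intro hi.2⟩
    · intro i _
      simp [smul_neg_index]
    · intro i _
      simp [smul_neg_index]
  have h2 : inversions P ρ w =
      (Finset.univ.filter (IsPos P ρ)).filter fun i => ¬ IsPos P ρ (w • i) := by
    ext i
    simp [mem_inversions]
  rw [length_eq_card P hρ, length_eq_card P hρ, length_eq_card P hρ,
    inversions_longest P hρ, h1, h2]
  exact Finset.card_filter_add_card_filter_not _

theorem eq_longest (hρ : IsRegular P ρ) {w : P.weylGroup}
    (hw : length P ρ w = length P ρ (longest P ρ)) : w = longest P ρ := by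
  have key : ∀ w : P.weylGroup, length P ρ w = length P ρ (longest P ρ) →
      w = (longest P ρ)⁻¹ := fun w hw => by
    have h := length_mul_longest P hρ w
    exact eq_inv_of_mul_eq_one_left (eq_one_of_length_eq_zero P hρ (by omega))
  rw [key w hw, ← key _ rfl]

theorem length_inv_mul_longest (hρ : IsRegular P ρ) (w : P.weylGroup) :
    length P ρ (w⁻¹ * longest P ρ) + length P ρ w = length P ρ (longest P ρ) := by
  rw [← length_inv P hρ w, length_mul_longest P hρ]

/-! ### Parabolic subgroups -/

/-- Every element of `W_J` has a reduced word with letters in `J`. -/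
theorem exists_reducedWord_of_mem_parabolic (hρ : IsRegular P ρ) {J : Set ι} (hJ : J ⊆ simple P ρ)
    {x : P.weylGroup} (hx : x ∈ parabolic P J) :
    ∃ l, IsReducedWord P ρ l x ∧ ∀ s ∈ l, (s : ι) ∈ J := by
  obtain ⟨l, rfl, hl⟩ : ∃ l, wordProd P ρ l = x ∧ ∀ s ∈ l, (s : ι) ∈ J := by
    rw [parabolic] at hx
    induction hx using Subgroup.closure_induction with
    | mem x hx =>
      obtain ⟨i, hi, rfl⟩ := hx
      exact ⟨[⟨i, hJ hi⟩], by simp, by simpa⟩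
    | one => exact ⟨[], rfl, by simp⟩
    | mul x y _ _ hx hy =>
      obtain ⟨l, rfl, hl⟩ := hx
      obtain ⟨l', rfl, hl'⟩ := hy
      refine ⟨l ++ l', by simp, fun s hs => ?_⟩
      exact (List.mem_append.1 hs).elim (hl s) (hl' s)
    | inv x _ hx =>
      obtain ⟨l, rfl, hl⟩ := hx
      exact ⟨l.reverse, wordProd_reverse P l, fun s hs => hl s (List.mem_reverse.1 hs)⟩
  clear hx
  induction l with
  | nil =>
    exact ⟨[], ⟨rfl, (length_one P).symm⟩, by simp⟩
  | cons s l ih =>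
    obtain ⟨l', ⟨h1, h2⟩, h3⟩ := ih fun t ht => hl t (List.mem_cons_of_mem _ ht)
    have hs : (s : ι) ∈ J := hl s List.mem_cons_self
    rw [wordProd_cons, ← h1]
    rw [← h1] at h2
    by_cases hpos : IsPos P ρ ((wordProd P ρ l')⁻¹ • (s : ι))
    · refine ⟨s :: l', ⟨wordProd_cons P s l', ?_⟩, fun t ht => ?_⟩
      · rw [length_refl_mul P hρ s.2 hpos, List.length_cons, h2]
      · exact (List.mem_cons.1 ht).elim (fun h => h ▸ hs) (h3 t)
    · obtain ⟨l'', h4, h5, h6⟩ := exists_erasure P hρ h2.symm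
        ((IsRegular.isPos_neg_iff P hρ).2 hpos) (by
          rw [smul_neg_index, smul_inv_smul, IsRegular.isPos_neg_iff P hρ]
          exact not_not_intro s.2.1)
      rw [refl_neg, refl_smul_index, inv_inv] at h5
      simp only [mul_assoc, mul_inv_cancel_left] at h5
      have := length_refl_mul_of_not_isPos P hρ s.2 hpos
      exact ⟨l'', ⟨h5, by omega⟩, fun t ht => h3 t (h6 t ht)⟩

/-- Lengths add in `u · x` for `u ∈ W^J` and `x ∈ W_J`. Here `u` makes no positive root `α` with
`s_α ∈ W_J` negative, because `u s_α` is not shorter than `u`. -/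
theorem length_mul_of_mem_minCosetReps (hρ : IsRegular P ρ) {J : Set ι} (hJ : J ⊆ simple P ρ)
    {u x : P.weylGroup} (hu : u ∈ minCosetReps P ρ J) (hx : x ∈ parabolic P J) :
    length P ρ (u * x) = length P ρ u + length P ρ x := by
  obtain ⟨l, ⟨rfl, hl⟩, hlJ⟩ := exists_reducedWord_of_mem_parabolic P hρ hJ hx
  clear hx
  induction l using List.reverseRecOn with
  | nil =>
    rw [← hl]
    simp
  | append_singleton l s ih =>
    have hs : (s : ι) ∈ J := hlJ s (by simp)
    have hlJ' : ∀ t ∈ l, (t : ι) ∈ J := fun t ht => hlJ t (by simp [ht])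
    have hmem := wordProd_mem_parabolic P hlJ'
    simp only [wordProd_append, wordProd_cons, wordProd_nil, mul_one, List.length_append,
      List.length_singleton] at hl ⊢
    have hle := length_wordProd_le P l
    have hpos : IsPos P ρ (wordProd P ρ l • (s : ι)) := by
      by_contra h
      have := length_mul_refl_of_not_isPos P hρ s.2 h
      omega
    rw [length_mul_refl P hρ s.2 hpos] at hl ⊢
    have hpos' : IsPos P ρ ((u * wordProd P ρ l) • (s : ι)) := by
      by_contra h
      rw [mul_smul] at h
      refine (length_mul_refl_lt P hρ hpos h).not_ge (hu _ ?_)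
      rw [refl_smul_index]
      exact mul_mem (mul_mem hmem (Subgroup.subset_closure ⟨s, hs, rfl⟩)) (inv_mem hmem)
    rw [← mul_assoc, length_mul_refl P hρ s.2 hpos', ih hlJ' (by omega)]
    omega

end Length

/-! ### Divided differences -/

theorem symmetricAlgebra_ι_injective : Function.Injective (SymmetricAlgebra.ι 𝕜 M) := by
  rw [injective_iff_map_eq_zero]
  intro m hm
  rw [← Module.forall_dual_apply_eq_zero_iff 𝕜]
  intro φ
  rw [← SymmetricAlgebra.lift_ι_apply φ m, hm, map_zero]

section Basic

variable (P : RootPairing ι 𝕜 M N)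

@[simp]
theorem polyAct_ι (w : P.weylGroup) (m : M) :
    polyAct P w (SymmetricAlgebra.ι 𝕜 M m) = SymmetricAlgebra.ι 𝕜 M (w • m) :=
  SymmetricAlgebra.lift_ι_apply _ m

@[simp]
theorem polyAct_one (f : SymmetricAlgebra 𝕜 M) : polyAct P 1 f = f := by
  have : polyAct P 1 = AlgHom.id 𝕜 _ := SymmetricAlgebra.algHom_ext (by ext m; simp)
  rw [this, AlgHom.id_apply]

theorem polyAct_mul (v w : P.weylGroup) (f : SymmetricAlgebra 𝕜 M) :
    polyAct P (v * w) f = polyAct P v (polyAct P w f) := by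
  have : polyAct P (v * w) = (polyAct P v).comp (polyAct P w) :=
    SymmetricAlgebra.algHom_ext (by ext m; simp [mul_smul])
  rw [this, AlgHom.comp_apply]

theorem polyAct_refl_refl (i : ι) (f : SymmetricAlgebra 𝕜 M) :
    polyAct P (refl P i) (polyAct P (refl P i) f) = f := by
  rw [← polyAct_mul, refl_mul_self, polyAct_one]

theorem polyAct_rootPoly (w : P.weylGroup) (i : ι) :
    polyAct P w (rootPoly P i) = rootPoly P (w • i) := by
  rw [rootPoly, polyAct_ι, ← root_smul, rootPoly]

theorem rootPoly_neg (i : ι) : rootPoly P (neg P i) = -rootPoly P i := by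
  rw [rootPoly, root_neg, map_neg, rootPoly]

theorem polyAct_refl_rootPoly (i : ι) : polyAct P (refl P i) (rootPoly P i) = -rootPoly P i := by
  rw [polyAct_rootPoly, ← rootPoly_neg, neg]

theorem polyAct_injective {v w : P.weylGroup} (h : ∀ f, polyAct P v f = polyAct P w f) : v = w := by
  refine weylGroup_ext P fun m => symmetricAlgebra_ι_injective (𝕜 := 𝕜) ?_
  rw [← polyAct_ι, ← polyAct_ι, h]

variable [CharZero 𝕜]

theorem rootPoly_ne_zero (i : ι) : rootPoly P i ≠ 0 := by
  have := Module.IsReflexive.of_isPerfPair P.toLinearMap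
  rw [rootPoly, Ne, map_eq_zero_iff _ symmetricAlgebra_ι_injective]
  exact P.ne_zero i

theorem divDiff_eq_of_mul_eq {i : ι} {f g : SymmetricAlgebra 𝕜 M}
    (h : rootPoly P i * g = f - polyAct P (refl P i) f) : divDiff P i f = g :=
  mul_left_cancel₀ (rootPoly_ne_zero P i) ((rootPoly_mul_divDiff P i f).trans h.symm)

theorem divDiff_add (i : ι) (f g : SymmetricAlgebra 𝕜 M) :
    divDiff P i (f + g) = divDiff P i f + divDiff P i g := by
  apply divDiff_eq_of_mul_eq
  rw [mul_add, rootPoly_mul_divDiff, rootPoly_mul_divDiff, map_add]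
  ring

/-- The twisted Leibniz rule. -/
theorem divDiff_mul (i : ι) (f g : SymmetricAlgebra 𝕜 M) :
    divDiff P i (f * g) = divDiff P i f * g + polyAct P (refl P i) f * divDiff P i g := by
  apply divDiff_eq_of_mul_eq
  rw [mul_add, ← mul_assoc, rootPoly_mul_divDiff, mul_left_comm, rootPoly_mul_divDiff, map_mul]
  ring

theorem divDiff_eq_zero_iff {i : ι} {f : SymmetricAlgebra 𝕜 M} :
    divDiff P i f = 0 ↔ polyAct P (refl P i) f = f := by
  constructor
  · intro h
    have := rootPoly_mul_divDiff P i f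
    rw [h, mul_zero, eq_comm, sub_eq_zero] at this
    exact this.symm
  · intro h
    apply divDiff_eq_of_mul_eq
    rw [h, mul_zero, sub_self]

theorem divDiff_mul_of_invariant {i : ι} {f : SymmetricAlgebra 𝕜 M}
    (hf : polyAct P (refl P i) f = f) (g : SymmetricAlgebra 𝕜 M) :
    divDiff P i (f * g) = f * divDiff P i g := by
  rw [divDiff_mul, (divDiff_eq_zero_iff P).2 hf, hf, zero_mul, zero_add]

@[simp]
theorem divDiff_algebraMap (i : ι) (c : 𝕜) :
    divDiff P i (algebraMap 𝕜 (SymmetricAlgebra 𝕜 M) c) = 0 := by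
  rw [divDiff_eq_zero_iff, AlgHom.commutes]

theorem divDiff_smul (i : ι) (c : 𝕜) (f : SymmetricAlgebra 𝕜 M) :
    divDiff P i (c • f) = c • divDiff P i f := by
  rw [Algebra.smul_def, Algebra.smul_def, divDiff_mul_of_invariant P (AlgHom.commutes _ c)]

theorem divDiff_ι (i : ι) (m : M) :
    divDiff P i (SymmetricAlgebra.ι 𝕜 M m) = algebraMap 𝕜 _ (P.coroot' i m) := by
  apply divDiff_eq_of_mul_eq
  rw [polyAct_ι, refl_smul, map_sub, map_smul, sub_sub_cancel, Algebra.smul_def, mul_comm, rootPoly]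

theorem polyAct_divDiff (i : ι) (f : SymmetricAlgebra 𝕜 M) :
    polyAct P (refl P i) (divDiff P i f) = divDiff P i f := by
  have h := congrArg (polyAct P (refl P i)) (rootPoly_mul_divDiff P i f)
  rw [map_mul, map_sub, polyAct_refl_refl, polyAct_refl_rootPoly] at h
  refine (divDiff_eq_of_mul_eq P ?_).symm
  rw [← neg_sub, ← h, neg_mul, neg_neg]

@[simp]
theorem divDiff_divDiff (i : ι) (f : SymmetricAlgebra 𝕜 M) : divDiff P i (divDiff P i f) = 0 :=
  (divDiff_eq_zero_iff P).2 (polyAct_divDiff P i f)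

theorem divDiff_polyAct (i : ι) (f : SymmetricAlgebra 𝕜 M) :
    divDiff P i (polyAct P (refl P i) f) = -divDiff P i f := by
  apply divDiff_eq_of_mul_eq
  rw [mul_neg, rootPoly_mul_divDiff, polyAct_refl_refl]
  ring

/-- The divided difference as a linear map. -/
def divDiffLin (i : ι) : SymmetricAlgebra 𝕜 M →ₗ[𝕜] SymmetricAlgebra 𝕜 M where
  toFun := divDiff P i
  map_add' := divDiff_add P i
  map_smul' := divDiff_smul P i

@[simp]
theorem divDiffLin_apply (i : ι) (f : SymmetricAlgebra 𝕜 M) :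
    divDiffLin P i f = divDiff P i f := rfl

@[simp]
theorem divDiff_zero (i : ι) : divDiff P i 0 = 0 := map_zero (divDiffLin P i)

end Basic

section Words

variable [LinearOrder 𝕜] (P : RootPairing ι 𝕜 M N) {ρ : N}

@[simp]
theorem divDiffWord_nil (f : SymmetricAlgebra 𝕜 M) : divDiffWord P ρ [] f = f := rfl

@[simp]
theorem divDiffWord_cons (s : simple P ρ) (l : List (simple P ρ)) (f : SymmetricAlgebra 𝕜 M) :
    divDiffWord P ρ (s :: l) f = divDiff P s (divDiffWord P ρ l f) := rfl

theorem divDiffWord_append (l l' : List (simple P ρ)) (f : SymmetricAlgebra 𝕜 M) :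
    divDiffWord P ρ (l ++ l') f = divDiffWord P ρ l (divDiffWord P ρ l' f) := by
  induction l with
  | nil => rfl
  | cons s l ih => simp [ih]

variable [IsStrictOrderedRing 𝕜]

/-- The composite of divided differences along a word, as a linear map. -/
def divDiffWordLin (ρ : N) (l : List (simple P ρ)) :
    SymmetricAlgebra 𝕜 M →ₗ[𝕜] SymmetricAlgebra 𝕜 M where
  toFun := divDiffWord P ρ l
  map_add' f g := by
    induction l with
    | nil => rfl
    | cons s l ih => simp [ih, divDiff_add]
  map_smul' c f := by
    induction l with
    | nil => rfl
    | cons s l ih =>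
      rw [divDiffWord_cons, ih]
      exact divDiff_smul P s c _

@[simp]
theorem divDiffWordLin_apply (l : List (simple P ρ)) (f : SymmetricAlgebra 𝕜 M) :
    divDiffWordLin P ρ l f = divDiffWord P ρ l f := rfl

theorem divDiffWord_one {l : List (simple P ρ)} (hl : l ≠ []) :
    divDiffWord P ρ l (1 : SymmetricAlgebra 𝕜 M) = 0 := by
  induction l with
  | nil => exact absurd rfl hl
  | cons s l ih =>
    rw [divDiffWord_cons]
    by_cases h : l = []
    · rw [h, divDiffWord_nil, ← map_one (algebraMap 𝕜 (SymmetricAlgebra 𝕜 M)), divDiff_algebraMap]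
    · rw [ih h, divDiff_zero]

theorem divDiffWord_mul_of_invariant {l : List (simple P ρ)} {f : SymmetricAlgebra 𝕜 M}
    (hf : ∀ s ∈ l, polyAct P (refl P s) f = f) (g : SymmetricAlgebra 𝕜 M) :
    divDiffWord P ρ l (f * g) = f * divDiffWord P ρ l g := by
  induction l with
  | nil => rfl
  | cons s l ih =>
    rw [divDiffWord_cons, ih fun t ht => hf t (List.mem_cons_of_mem _ ht),
      divDiff_mul_of_invariant P (hf s List.mem_cons_self), divDiffWord_cons]

/-- Commutation of divided differences with multiplication by a linear form. -/
theorem divDiffWord_ι_mul (l : List (simple P ρ)) (m : M) (f : SymmetricAlgebra 𝕜 M) :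
    divDiffWord P ρ l (SymmetricAlgebra.ι 𝕜 M m * f) =
      SymmetricAlgebra.ι 𝕜 M (wordProd P ρ l • m) * divDiffWord P ρ l f +
        ((erasures P l).map fun p => P.coroot' p.1 m • divDiffWord P ρ p.2 f).sum := by
  induction l with
  | nil => simp [erasures]
  | cons s l ih =>
    have h : divDiff P s ((erasures P l).map fun p => P.coroot' p.1 m • divDiffWord P ρ p.2 f).sum =
        ((erasures P l).map fun p => P.coroot' p.1 m • divDiffWord P ρ (s :: p.2) f).sum := by
      rw [← divDiffLin_apply, map_list_sum, List.map_map]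
      congr 2
      ext p
      simp
    rw [divDiffWord_cons, ih, divDiff_add, divDiff_mul, h, divDiff_ι, polyAct_ι, erasures,
      List.map_cons, List.sum_cons, List.map_map, coroot'_smul, wordProd_cons, mul_smul,
      Algebra.smul_def, divDiffWord_cons, Function.comp_def]
    ring

/-- The divided difference `∂_w` as a linear map. -/
def divDiffEltLin (ρ : N) (w : P.weylGroup) : SymmetricAlgebra 𝕜 M →ₗ[𝕜] SymmetricAlgebra 𝕜 M :=
  divDiffWordLin P ρ (reducedWord P ρ w)

@[simp]
theorem divDiffEltLin_apply (w : P.weylGroup) (f : SymmetricAlgebra 𝕜 M) :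
    divDiffEltLin P ρ w f = divDiffElt P ρ w f := rfl

variable [Fintype ι] [P.IsReduced]

/-- Two reduced words of the same element give the same divided difference, and words that are not
reduced give zero. Instead of braid relations, the proof uses `divDiffWord_ι_mul`: by
induction, the sum over the erasures of a reduced word only depends on its product, so that the
difference of two such operators commutes with multiplication by linear forms up to a twist; as it
kills `1`, it vanishes. -/
theorem divDiffWord_wellDefined (hρ : IsRegular P ρ) (n : ℕ) :
    (∀ l : List (simple P ρ), l.length = n → length P ρ (wordProd P ρ l) ≠ n →
      ∀ f : SymmetricAlgebra 𝕜 M, divDiffWord P ρ l f = 0) ∧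
    ∀ l l' : List (simple P ρ), l.length = n → l'.length = n → wordProd P ρ l = wordProd P ρ l' →
      length P ρ (wordProd P ρ l) = n →
      ∀ f : SymmetricAlgebra 𝕜 M, divDiffWord P ρ l f = divDiffWord P ρ l' f := by
  induction n with
  | zero =>
    refine ⟨fun l hl h => ?_, fun l l' hl hl' _ _ f => ?_⟩
    · rw [List.length_eq_zero_iff] at hl
      subst hl
      exact absurd (length_one P) h
    · rw [List.length_eq_zero_iff] at hl hl'
      rw [hl, hl']
  | succ n ih =>
    obtain ⟨ih0, ih1⟩ := ih
    constructor
    · rintro (_ | ⟨s, l⟩) hl h f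
      · simp at hl
      have hl : l.length = n := by simpa using hl
      rw [divDiffWord_cons]
      by_cases h' : length P ρ (wordProd P ρ l) = n
      · have hneg : ¬ IsPos P ρ ((wordProd P ρ l)⁻¹ • (s : ι)) := fun hpos =>
          h (by rw [wordProd_cons, length_refl_mul P hρ s.2 hpos, h'])
        have h1 := length_refl_mul_of_not_isPos P hρ s.2 hneg
        obtain ⟨r, hr, hr'⟩ := exists_isReducedWord P hρ (refl P s * wordProd P ρ l)
        rw [ih1 l (s :: r) hl (by rw [List.length_cons]; omega) _ h', divDiffWord_cons,
          divDiff_divDiff]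
        rw [wordProd_cons, hr, ← mul_assoc, refl_mul_self, one_mul]
      · rw [ih0 l hl h', divDiff_zero]
    · intro l l' hl hl' hll' hred f
      -- the common value of `divDiffWord` on the words of length `n` with product `v`
      let E : P.weylGroup → SymmetricAlgebra 𝕜 M → SymmetricAlgebra 𝕜 M := fun v f =>
        if length P ρ v = n then divDiffElt P ρ v f else 0
      have hE : ∀ r : List (simple P ρ), r.length = n → ∀ f,
          divDiffWord P ρ r f = E (wordProd P ρ r) f := by
        intro r hr f
        simp only [E]
        split_ifs with h
        · have := isReducedWord_reducedWord P hρ (wordProd P ρ r)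
          exact ih1 _ _ hr (this.2.trans h) this.1.symm h f
        · exact ih0 r hr h f
      have hsum : ∀ r : List (simple P ρ), r.length = n + 1 → ∀ m f,
          ((erasures P r).map fun p => P.coroot' p.1 m • divDiffWord P ρ p.2 f).sum =
            ((wordRoots P r).map fun i =>
              P.coroot' i m • E (wordProd P ρ r * refl P i) f).sum := by
        intro r hr m f
        rw [wordRoots, List.map_map]
        congr 1
        refine List.map_congr_left fun p hp => ?_
        obtain ⟨h1, h2, -⟩ := mem_erasures P hp
        rw [hE _ (by omega), h2]
        rfl
      have hperm : (wordRoots P l).Perm (wordRoots P l') := by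
        obtain ⟨h1, h2⟩ := wordRoots_of_reduced P hρ (hred.trans hl.symm)
        obtain ⟨h3, h4⟩ := wordRoots_of_reduced P hρ ((hll' ▸ hred).trans hl'.symm)
        rw [List.perm_ext_iff_of_nodup h1 h3]
        intro i
        rw [h2, h4, hll']
      let B := divDiffWordLin P ρ l - divDiffWordLin P ρ l'
      have hB : ∀ m f, B (SymmetricAlgebra.ι 𝕜 M m * f) =
          SymmetricAlgebra.ι 𝕜 M (wordProd P ρ l • m) * B f := by
        intro m f
        simp only [B, LinearMap.sub_apply, divDiffWordLin_apply, divDiffWord_ι_mul, hsum l hl,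
          hsum l' hl', ← hll']
        rw [(hperm.map _).sum_eq]
        ring
      have key : ∀ g f, B f = 0 → B (g * f) = 0 := by
        intro g
        induction g using SymmetricAlgebra.induction with
        | algebraMap c =>
          intro f hf
          rw [← Algebra.smul_def, map_smul, hf, smul_zero]
        | ι m =>
          intro f hf
          rw [hB, hf, mul_zero]
        | mul a b ha hb =>
          intro f hf
          rw [mul_assoc]
          exact ha _ (hb _ hf)
        | add a b ha hb =>
          intro f hf
          rw [add_mul, map_add, ha _ hf, hb _ hf, add_zero]
      have h1 : B 1 = 0 := by
        simp only [B, LinearMap.sub_apply, divDiffWordLin_apply]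
        rw [divDiffWord_one, divDiffWord_one, sub_zero] <;> rintro rfl <;> simp at hl hl'
      have h2 := key f 1 h1
      rw [mul_one] at h2
      exact sub_eq_zero.1 h2

theorem divDiffWord_eq_divDiffElt (hρ : IsRegular P ρ) {l : List (simple P ρ)}
    (hl : length P ρ (wordProd P ρ l) = l.length) (f : SymmetricAlgebra 𝕜 M) :
    divDiffWord P ρ l f = divDiffElt P ρ (wordProd P ρ l) f := by
  obtain ⟨h1, h2⟩ := isReducedWord_reducedWord P hρ (wordProd P ρ l)
  exact (divDiffWord_wellDefined P hρ l.length).2 _ _ rfl (h2.trans hl) h1.symm hl f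

theorem divDiffWord_eq_zero (hρ : IsRegular P ρ) {l : List (simple P ρ)}
    (hl : length P ρ (wordProd P ρ l) ≠ l.length) (f : SymmetricAlgebra 𝕜 M) :
    divDiffWord P ρ l f = 0 :=
  (divDiffWord_wellDefined P hρ l.length).1 _ rfl hl f

theorem divDiffElt_divDiffElt (hρ : IsRegular P ρ) {v w : P.weylGroup}
    (h : length P ρ (v * w) = length P ρ v + length P ρ w) (f : SymmetricAlgebra 𝕜 M) :
    divDiffElt P ρ v (divDiffElt P ρ w f) = divDiffElt P ρ (v * w) f := by
  obtain ⟨h1, h2⟩ := isReducedWord_reducedWord P hρ v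
  obtain ⟨h3, h4⟩ := isReducedWord_reducedWord P hρ w
  rw [divDiffElt, divDiffElt, ← divDiffWord_append, divDiffWord_eq_divDiffElt P hρ,
    wordProd_append, h1, h3]
  rw [wordProd_append, h1, h3, List.length_append, h2, h4, h]

theorem divDiffElt_divDiffElt_eq_zero (hρ : IsRegular P ρ) {v w : P.weylGroup}
    (h : length P ρ (v * w) ≠ length P ρ v + length P ρ w) (f : SymmetricAlgebra 𝕜 M) :
    divDiffElt P ρ v (divDiffElt P ρ w f) = 0 := by
  obtain ⟨h1, h2⟩ := isReducedWord_reducedWord P hρ v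
  obtain ⟨h3, h4⟩ := isReducedWord_reducedWord P hρ w
  rw [divDiffElt, divDiffElt, ← divDiffWord_append, divDiffWord_eq_zero P hρ]
  rwa [wordProd_append, h1, h3, List.length_append, h2, h4]

theorem divDiffElt_refl (hρ : IsRegular P ρ) {s : ι} (hs : s ∈ simple P ρ)
    (f : SymmetricAlgebra 𝕜 M) : divDiffElt P ρ (refl P s) f = divDiff P s f := by
  have h1 : wordProd P ρ [⟨s, hs⟩] = refl P s := by simp
  have h2 := divDiffWord_eq_divDiffElt P hρ (l := [⟨s, hs⟩]) ?_ f
  · rw [← h1, ← h2]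
    rfl
  · rw [h1, length_refl P hρ hs]
    rfl

theorem divDiffElt_one (hρ : IsRegular P ρ) (f : SymmetricAlgebra 𝕜 M) :
    divDiffElt P ρ 1 f = f := by
  exact (divDiffWord_eq_divDiffElt P hρ (l := []) (length_one P) f).symm

end Words

/-! ### The grading -/

section Grading

variable (𝕜 M) in
/-- The homogeneous elements of degree `n` in `𝕜[V]`. -/
abbrev homog (n : ℕ) : Submodule 𝕜 (SymmetricAlgebra 𝕜 M) :=
  LinearMap.range (SymmetricAlgebra.ι 𝕜 M) ^ n

theorem mul_mem_homog {m n : ℕ} {f g : SymmetricAlgebra 𝕜 M} (hf : f ∈ homog 𝕜 M m)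
    (hg : g ∈ homog 𝕜 M n) : f * g ∈ homog 𝕜 M (m + n) := by
  rw [homog, pow_add]
  exact Submodule.mul_mem_mul hf hg

theorem ι_mem_homog (m : M) : SymmetricAlgebra.ι 𝕜 M m ∈ homog 𝕜 M 1 := by
  rw [homog, pow_one]
  exact ⟨m, rfl⟩

theorem mem_homog_zero {f : SymmetricAlgebra 𝕜 M} (hf : f ∈ homog 𝕜 M 0) :
    ∃ c, algebraMap 𝕜 _ c = f := by
  rw [homog, pow_zero] at hf
  exact Submodule.mem_one.1 hf

/-- Induction for homogeneous elements. -/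
theorem homog_induction {motive : ℕ → SymmetricAlgebra 𝕜 M → Prop}
    (algebraMap : ∀ c, motive 0 (algebraMap 𝕜 _ c))
    (add : ∀ n f g, motive n f → motive n g → motive n (f + g))
    (ι_mul : ∀ n m f, f ∈ homog 𝕜 M n → motive n f → motive (n + 1) (SymmetricAlgebra.ι 𝕜 M m * f))
    {n : ℕ} {f : SymmetricAlgebra 𝕜 M} (hf : f ∈ homog 𝕜 M n) : motive n f := by
  induction n generalizing f with
  | zero =>
    obtain ⟨c, rfl⟩ := mem_homog_zero hf
    exact algebraMap c
  | succ n ih =>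
    rw [homog, pow_succ'] at hf
    refine Submodule.mul_induction_on hf ?_ fun a b ha hb => add _ a b ha hb
    rintro _ ⟨m, rfl⟩ g hg
    exact ι_mul n m g hg (ih hg)

theorem algebraMapInv_of_mem_homog {n : ℕ} (hn : 0 < n) {f : SymmetricAlgebra 𝕜 M}
    (hf : f ∈ homog 𝕜 M n) : SymmetricAlgebra.algebraMapInv f = 0 := by
  refine homog_induction (motive := fun n f => 0 < n → SymmetricAlgebra.algebraMapInv f = 0)
    (fun c h => absurd h (lt_irrefl 0)) (fun n f g h1 h2 h => ?_) (fun n m f _ _ _ => ?_) hf hn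
  · rw [map_add, h1 h, h2 h, add_zero]
  · rw [map_mul, SymmetricAlgebra.algebraMapInv_ι, zero_mul]

variable (P : RootPairing ι 𝕜 M N)

theorem polyAct_mem_homog (w : P.weylGroup) {n : ℕ} {f : SymmetricAlgebra 𝕜 M}
    (hf : f ∈ homog 𝕜 M n) : polyAct P w f ∈ homog 𝕜 M n := by
  refine homog_induction (motive := fun n f => polyAct P w f ∈ homog 𝕜 M n)
    (fun c => ?_) (fun n f g h1 h2 => ?_) (fun n m f _ h => ?_) hf
  · rw [AlgHom.commutes, homog, pow_zero]
    exact Submodule.mem_one.2 ⟨c, rfl⟩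
  · rw [map_add]
    exact add_mem h1 h2
  · rw [map_mul, polyAct_ι, add_comm]
    exact mul_mem_homog (ι_mem_homog _) h

variable [CharZero 𝕜]

theorem divDiff_of_mem_homog_zero (i : ι) {f : SymmetricAlgebra 𝕜 M} (hf : f ∈ homog 𝕜 M 0) :
    divDiff P i f = 0 := by
  obtain ⟨c, rfl⟩ := mem_homog_zero hf
  exact divDiff_algebraMap P i c

theorem divDiff_mem_homog (i : ι) {n : ℕ} {f : SymmetricAlgebra 𝕜 M} (hf : f ∈ homog 𝕜 M n) :
    divDiff P i f ∈ homog 𝕜 M (n - 1) := by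
  refine homog_induction (motive := fun n f => divDiff P i f ∈ homog 𝕜 M (n - 1))
    (fun c => ?_) (fun n f g h1 h2 => ?_) (fun n m f hf h => ?_) hf
  · rw [divDiff_algebraMap]
    exact zero_mem _
  · rw [divDiff_add]
    exact add_mem h1 h2
  · rw [divDiff_mul, divDiff_ι, ← Algebra.smul_def, Nat.add_sub_cancel]
    refine add_mem (Submodule.smul_mem _ _ hf) ?_
    rcases n with _ | n
    · rw [divDiff_of_mem_homog_zero P i hf, mul_zero]
      exact zero_mem _
    · rw [polyAct_ι, add_comm n 1]
      exact mul_mem_homog (ι_mem_homog _) (by simpa using h)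

end Grading

section Words

variable [LinearOrder 𝕜] [IsStrictOrderedRing 𝕜] (P : RootPairing ι 𝕜 M N) {ρ : N}

theorem divDiffWord_mem_homog (l : List (simple P ρ)) {n : ℕ} {f : SymmetricAlgebra 𝕜 M}
    (hf : f ∈ homog 𝕜 M n) : divDiffWord P ρ l f ∈ homog 𝕜 M (n - l.length) := by
  induction l with
  | nil => exact hf
  | cons s l ih =>
    rw [List.length_cons, ← Nat.sub_sub]
    exact divDiff_mem_homog P s ih

theorem divDiffWord_eq_zero_of_lt (l : List (simple P ρ)) {n : ℕ} {f : SymmetricAlgebra 𝕜 M}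
    (hf : f ∈ homog 𝕜 M n) (hn : n < l.length) : divDiffWord P ρ l f = 0 := by
  cases l with
  | nil => exact absurd hn (Nat.not_lt_zero n)
  | cons s l =>
    rw [List.length_cons] at hn
    refine divDiff_of_mem_homog_zero P s ?_
    have := divDiffWord_mem_homog P l hf
    rwa [Nat.sub_eq_zero_of_le (Nat.le_of_lt_succ hn)] at this

variable [Fintype ι] [P.IsReduced]

theorem divDiffElt_mem_homog (hρ : IsRegular P ρ) (w : P.weylGroup) {n : ℕ}
    {f : SymmetricAlgebra 𝕜 M} (hf : f ∈ homog 𝕜 M n) :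
    divDiffElt P ρ w f ∈ homog 𝕜 M (n - length P ρ w) := by
  rw [← (isReducedWord_reducedWord P hρ w).2]
  exact divDiffWord_mem_homog P _ hf

theorem divDiffElt_eq_zero_of_lt (hρ : IsRegular P ρ) (w : P.weylGroup) {n : ℕ}
    {f : SymmetricAlgebra 𝕜 M} (hf : f ∈ homog 𝕜 M n) (hn : n < length P ρ w) :
    divDiffElt P ρ w f = 0 := by
  rw [← (isReducedWord_reducedWord P hρ w).2] at hn
  exact divDiffWord_eq_zero_of_lt P _ hf hn

end Words

/-! ### The top Schubert polynomial -/

section Top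

variable [LinearOrder 𝕜] (P : RootPairing ι 𝕜 M N) {ρ : N} [Fintype ι]

open Classical in
/-- The product of the positive roots. -/
def posProd (ρ : N) : SymmetricAlgebra 𝕜 M := ∏ i with IsPos P ρ i, rootPoly P i

theorem topSchubert_eq : topSchubert P ρ = (Nat.card P.weylGroup : 𝕜)⁻¹ • posProd P ρ := rfl

variable [IsStrictOrderedRing 𝕜]

theorem polyAct_posProd (hρ : IsRegular P ρ) {s : ι} (hs : s ∈ simple P ρ) :
    polyAct P (refl P s) (posProd P ρ) = -posProd P ρ := by
  classical
  have hmem : s ∈ Finset.univ.filter (IsPos P ρ) := by simpa using hs.1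
  rw [posProd, ← Finset.mul_prod_erase _ _ hmem, map_mul, polyAct_refl_rootPoly, neg_mul, map_prod]
  congr 2
  refine Finset.prod_bij' (fun i _ => refl P s • i) (fun i _ => refl P s • i) ?_ ?_ ?_ ?_ ?_
  · intro i hi
    simp only [Finset.mem_erase, Finset.mem_filter, Finset.mem_univ, true_and] at hi ⊢
    refine ⟨?_, isPos_refl_smul P hρ hs hi.2 hi.1⟩
    intro h
    apply not_isPos_refl_smul_self P hρ hs
    rw [← h, ← mul_smul, h, refl_mul_self, one_smul]
    exact hi.2
  · intro i hi
    simp only [Finset.mem_erase, Finset.mem_filter, Finset.mem_univ, true_and] at hi ⊢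
    refine ⟨?_, isPos_refl_smul P hρ hs hi.2 hi.1⟩
    intro h
    apply not_isPos_refl_smul_self P hρ hs
    rw [← h, ← mul_smul, h, refl_mul_self, one_smul]
    exact hi.2
  · intro i _
    rw [← mul_smul, refl_mul_self, one_smul]
  · intro i _
    rw [← mul_smul, refl_mul_self, one_smul]
  · intro i _
    rw [polyAct_rootPoly]

variable [P.IsReduced]

/-- A composite of divided differences, expanded as a combination of the elements of `W` with
coefficients in the field of fractions. For a reduced word, the coefficient of the product of
the word is explicit. -/
theorem exists_coeff_divDiffWord (K : Type*) [Field K]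
    [Algebra (SymmetricAlgebra 𝕜 M) K] [IsFractionRing (SymmetricAlgebra 𝕜 M) K]
    [Fintype P.weylGroup] (hρ : IsRegular P ρ)
    (l : List (simple P ρ)) :
    ∃ q : P.weylGroup → K,
      (∀ f, algebraMap _ K (divDiffWord P ρ l f) =
        ∑ v, q v * algebraMap _ K (polyAct P v f)) ∧
      (∀ v, l.length < length P ρ v → q v = 0) ∧
      (length P ρ (wordProd P ρ l) = l.length → q (wordProd P ρ l) *
        algebraMap _ K (polyAct P (wordProd P ρ l) ((wordRoots P l).map (rootPoly P)).prod) = 1) := by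
  classical
  induction l using List.reverseRecOn with
  | nil =>
    refine ⟨fun v => if v = 1 then 1 else 0, fun f => by simp, fun v hv => if_neg ?_, by simp⟩
    rintro rfl
    rw [length_one] at hv
    exact Nat.not_lt_zero _ hv
  | append_singleton l s ih =>
    obtain ⟨q, h1, h2, h3⟩ := ih
    let a : SymmetricAlgebra 𝕜 M →+* K := algebraMap _ _
    have ha : ∀ v : P.weylGroup, a (rootPoly P (v • (s : ι))) ≠ 0 := fun v => by
      rw [Ne, map_eq_zero_iff a (IsFractionRing.injective _ _)]
      exact rootPoly_ne_zero P _
    have hneg : ∀ v : P.weylGroup, a (rootPoly P ((v * refl P s) • (s : ι))) =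
        -a (rootPoly P (v • (s : ι))) := fun v => by
      rw [mul_smul, ← map_neg, ← rootPoly_neg, ← smul_neg_index, neg]
    -- from `∂_s = α_s⁻¹ (1 - s)` and `v s α_s = -v α_s`
    refine ⟨fun v => (q v + q (v * refl P s)) / a (rootPoly P (v • (s : ι))),
      fun f => ?_, fun v hv => ?_, fun hl => ?_⟩
    · have hd : ∀ v : P.weylGroup, a (polyAct P v (divDiff P s f)) =
          (a (polyAct P v f) - a (polyAct P (v * refl P s) f)) / a (rootPoly P (v • (s : ι))) := by
        intro v
        rw [eq_div_iff (ha v), mul_comm, ← map_mul, ← polyAct_rootPoly, ← map_mul,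
          rootPoly_mul_divDiff, map_sub, map_sub, polyAct_mul]
      have hsub : ∑ v : P.weylGroup, q (v * refl P s) / a (rootPoly P (v • (s : ι))) *
          a (polyAct P v f) = -∑ v : P.weylGroup, q v / a (rootPoly P (v • (s : ι))) *
            a (polyAct P (v * refl P s) f) := by
        rw [← Finset.sum_neg_distrib, ← Equiv.sum_comp (Equiv.mulRight (refl P (s : ι)))]
        refine Finset.sum_congr rfl fun v _ => ?_
        rw [Equiv.coe_mulRight, mul_assoc v, refl_mul_self, mul_one, hneg, div_neg, neg_mul]
      rw [divDiffWord_append, h1]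
      change ∑ v, q v * a (polyAct P v (divDiff P s f)) = ∑ v, _ * a (polyAct P v f)
      simp only [add_div, add_mul, Finset.sum_add_distrib, hd]
      rw [hsub, ← sub_eq_add_neg, ← Finset.sum_sub_distrib]
      refine Finset.sum_congr rfl fun v _ => ?_
      ring
    · rw [List.length_append, List.length_singleton] at hv
      have h4 := length_refl_mul_le P hρ s (v * refl P s)⁻¹
      rw [length_inv P hρ, mul_inv_rev, refl_inv, ← mul_assoc, refl_mul_self, one_mul,
        length_inv P hρ] at h4
      simp only
      rw [h2 v (by omega), h2 _ (by omega), add_zero, zero_div]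
    · simp only [wordProd_append, wordProd_cons, wordProd_nil, mul_one, List.length_append,
        List.length_singleton] at hl ⊢
      have hle := length_wordProd_le P l
      have hpos : IsPos P ρ (wordProd P ρ l • (s : ι)) := by
        by_contra h
        have := length_mul_refl_of_not_isPos P hρ s.2 h
        omega
      have hl' := length_mul_refl P hρ s.2 hpos
      have h4 := h3 (by omega)
      rw [h2 _ (by omega), zero_add, mul_assoc (wordProd P ρ l), refl_mul_self, mul_one,
        wordRoots_concat, List.map_append, List.prod_append, map_mul, map_mul]
      change _ / a _ * (a _ * a _) = 1
      have h5 : polyAct P (wordProd P ρ l * refl P s)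
          (((wordRoots P l).map (refl P (s : ι) • ·)).map (rootPoly P)).prod =
          polyAct P (wordProd P ρ l) ((wordRoots P l).map (rootPoly P)).prod := by
        rw [polyAct_mul]
        congr 1
        rw [map_list_prod, List.map_map, List.map_map]
        congr 2
        ext i
        simp only [Function.comp_apply, polyAct_rootPoly]
        rw [← mul_smul, refl_mul_self, one_smul]
      rw [h5]
      simp only [List.map_cons, List.map_nil, List.prod_singleton, polyAct_rootPoly]
      have h6 := ha (wordProd P ρ l * refl P s)
      field_simp
      exact h4

open Classical in
theorem posProd_mem_homog (hρ : IsRegular P ρ) :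
    posProd P ρ ∈ homog 𝕜 M (length P ρ (longest P ρ)) := by
  rw [length_eq_card P hρ, inversions_longest P hρ, posProd]
  generalize Finset.univ.filter (IsPos P ρ) = t
  induction t using Finset.induction_on with
  | empty =>
    rw [Finset.prod_empty, Finset.card_empty, homog, pow_zero]
    exact Submodule.one_le.1 le_rfl
  | insert i t hi ih =>
    rw [Finset.prod_insert hi, Finset.card_insert_of_notMem hi, add_comm]
    exact mul_mem_homog (ι_mem_homog _) ih

/-- `∂_{w₀}` of the product of the positive roots is the order of `W`. In the expansion
`∂_{w₀} = ∑ q_v v` over the field of fractions, `q_{vs} = -q_v` for every simple reflection `s`,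
because `∂_{w₀} s = -∂_{w₀}` and the elements of `W` are linearly independent characters. As the
product of the positive roots is anti-invariant as well, all terms of the sum are equal, and the one
for `w₀` is known. -/
theorem divDiffElt_longest_posProd (hρ : IsRegular P ρ) :
    divDiffElt P ρ (longest P ρ) (posProd P ρ) = algebraMap 𝕜 _ (Nat.card P.weylGroup : 𝕜) := by
  classical
  let _ : Fintype P.weylGroup := Fintype.ofFinite _
  obtain ⟨hw1, hw2⟩ := isReducedWord_reducedWord P hρ (longest P ρ)
  obtain ⟨q, h1, -, h3⟩ := exists_coeff_divDiffWord P
    (FractionRing (SymmetricAlgebra 𝕜 M)) hρ (reducedWord P ρ (longest P ρ))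
  rw [hw1] at h3
  specialize h3 hw2.symm
  let a : SymmetricAlgebra 𝕜 M →+* FractionRing (SymmetricAlgebra 𝕜 M) := algebraMap _ _
  have hprod : ((wordRoots P (reducedWord P ρ (longest P ρ))).map (rootPoly P)).prod =
      posProd P ρ := by
    obtain ⟨h4, h5⟩ := wordRoots_of_reduced P hρ (l := reducedWord P ρ (longest P ρ))
      (by rw [hw1, hw2])
    rw [← List.prod_toFinset _ h4, posProd]
    refine Finset.prod_congr ?_ fun _ _ => rfl
    ext i
    rw [List.mem_toFinset, h5, hw1]
    simp [mem_inversions, isPos_longest_smul_iff P hρ]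
  rw [hprod] at h3
  -- `∂_{w₀} s = -∂_{w₀}`
  have hanti : ∀ s ∈ simple P ρ, ∀ f, divDiffElt P ρ (longest P ρ) (polyAct P (refl P s) f) =
      -divDiffElt P ρ (longest P ρ) f := by
    intro s hs f
    have h6 : length P ρ (longest P ρ * refl P s) + 1 = length P ρ (longest P ρ) :=
      length_mul_refl_of_not_isPos P hρ hs
        fun h => (isPos_longest_smul_iff P hρ).1 h hs.1
    have h7 := length_refl P hρ hs
    have h8 : ∀ g, divDiffElt P ρ (longest P ρ) g =
        divDiffElt P ρ (longest P ρ * refl P s) (divDiff P s g) := by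
      intro g
      rw [← divDiffElt_refl P hρ hs, divDiffElt_divDiffElt P hρ] <;>
        rw [mul_assoc, refl_mul_self, mul_one]
      rw [h7, h6]
    rw [h8, h8 f, divDiff_polyAct, ← divDiffEltLin_apply, map_neg, divDiffEltLin_apply]
  have hq : ∀ s ∈ simple P ρ, ∀ v, q (v * refl P s) = -q v := by
    intro s hs
    let χ : P.weylGroup → (SymmetricAlgebra 𝕜 M →* FractionRing (SymmetricAlgebra 𝕜 M)) :=
      fun v => (a : _ →* _).comp (polyAct P v : SymmetricAlgebra 𝕜 M →* SymmetricAlgebra 𝕜 M)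
    have hχ : Function.Injective χ := fun v w h => polyAct_injective P fun f =>
      IsFractionRing.injective _ (FractionRing (SymmetricAlgebra 𝕜 M)) (DFunLike.congr_fun h f)
    have hli := (linearIndependent_monoidHom (SymmetricAlgebra 𝕜 M)
      (FractionRing (SymmetricAlgebra 𝕜 M))).comp χ hχ
    rw [Fintype.linearIndependent_iff] at hli
    have h9 := hli (fun v => q (v * refl P s) + q v) ?_
    · exact fun v => eq_neg_of_add_eq_zero_left (h9 v)
    · ext f
      have h10 := congrArg a (hanti s hs f)
      rw [map_neg, ← add_eq_zero_iff_eq_neg] at h10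
      change a (divDiffWord P ρ _ _) + a (divDiffWord P ρ _ _) = 0 at h10
      rw [h1, h1, ← Equiv.sum_comp (Equiv.mulRight (refl P s))] at h10
      simp only [Equiv.coe_mulRight, polyAct_mul, polyAct_refl_refl] at h10
      rw [← Finset.sum_add_distrib] at h10
      rw [Finset.sum_apply, Pi.zero_apply, ← h10]
      refine Finset.sum_congr rfl fun v _ => ?_
      simp only [← add_mul]
      rfl
  have hT : ∀ v, q v * a (polyAct P v (posProd P ρ)) = 1 := by
    have hstep : ∀ l : List (simple P ρ), ∀ v,
        q (v * wordProd P ρ l) * a (polyAct P (v * wordProd P ρ l) (posProd P ρ)) =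
          q v * a (polyAct P v (posProd P ρ)) := by
      intro l
      induction l with
      | nil => simp
      | cons s l ih =>
        intro v
        rw [wordProd_cons, ← mul_assoc, ih, hq _ s.2, polyAct_mul, polyAct_posProd P hρ s.2,
          map_neg, map_neg, neg_mul_neg]
    intro v
    obtain ⟨l, hl, -⟩ := exists_isReducedWord P hρ ((longest P ρ)⁻¹ * v)
    have := hstep l (longest P ρ)
    rw [hl, mul_inv_cancel_left] at this
    exact this.trans h3
  apply IsFractionRing.injective _ (FractionRing (SymmetricAlgebra 𝕜 M))
  change a (divDiffWord P ρ _ _) = a _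
  rw [h1]
  refine (Finset.sum_congr rfl fun v _ => hT v).trans ?_
  simp [Nat.card_eq_fintype_card]

theorem divDiffElt_longest_topSchubert (hρ : IsRegular P ρ) :
    divDiffElt P ρ (longest P ρ) (topSchubert P ρ) = 1 := by
  rw [topSchubert_eq, ← divDiffEltLin_apply, map_smul, divDiffEltLin_apply,
    divDiffElt_longest_posProd P hρ, Algebra.smul_def, ← map_mul, inv_mul_cancel₀, map_one]
  exact_mod_cast Nat.card_pos.ne'

theorem topSchubert_mem_homog (hρ : IsRegular P ρ) :
    topSchubert P ρ ∈ homog 𝕜 M (length P ρ (longest P ρ)) :=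
  Submodule.smul_mem _ _ (posProd_mem_homog P hρ)

end Top

/-! ### The Schubert basis of the coinvariant algebra -/

theorem polyAct_mem_invariantIdeal (P : RootPairing ι 𝕜 M N) (w : P.weylGroup)
    {f : SymmetricAlgebra 𝕜 M} (hf : f ∈ invariantIdeal P) : polyAct P w f ∈ invariantIdeal P := by
  rw [invariantIdeal] at hf
  refine Submodule.span_induction (fun g hg => ?_) ?_ (fun g h _ _ hg hh => ?_)
    (fun a g _ hg => ?_) hf
  · rw [hg.2 w]
    exact Ideal.subset_span hg
  · rw [map_zero]
    exact zero_mem _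
  · rw [map_add]
    exact add_mem hg hh
  · rw [smul_eq_mul, map_mul]
    exact Ideal.mul_mem_left _ _ hg

section Schubert

variable [LinearOrder 𝕜] [IsStrictOrderedRing 𝕜] (P : RootPairing ι 𝕜 M N) {ρ : N}

theorem divDiffElt_mul_of_invariant {f : SymmetricAlgebra 𝕜 M}
    (hf : ∀ w : P.weylGroup, polyAct P w f = f) (v : P.weylGroup) (g : SymmetricAlgebra 𝕜 M) :
    divDiffElt P ρ v (f * g) = f * divDiffElt P ρ v g :=
  divDiffWord_mul_of_invariant P (fun s _ => hf (refl P s)) g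

/-- The coordinate of `f` at `v` in the Schubert basis: the constant term of `∂_v f`. -/
def coord (ρ : N) (v : P.weylGroup) : SymmetricAlgebra 𝕜 M →ₗ[𝕜] 𝕜 :=
  SymmetricAlgebra.algebraMapInv.toLinearMap ∘ₗ divDiffEltLin P ρ v

theorem coord_apply (v : P.weylGroup) (f : SymmetricAlgebra 𝕜 M) :
    coord P ρ v f = SymmetricAlgebra.algebraMapInv (divDiffElt P ρ v f) := rfl

theorem coord_of_mem_invariantIdeal (v : P.weylGroup) {f : SymmetricAlgebra 𝕜 M}
    (hf : f ∈ invariantIdeal P) : coord P ρ v f = 0 := by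
  -- `coord P ρ v` is not linear over `𝕜[V]`, so the induction keeps track of all multiples
  suffices h : ∀ a, coord P ρ v (f * a) = 0 by simpa using h 1
  rw [invariantIdeal] at hf
  refine Submodule.span_induction (fun g hg a => ?_) (fun a => ?_) (fun g h _ _ hg hh a => ?_)
    (fun b g _ hg a => ?_) hf
  · obtain ⟨⟨n, hn, hgn⟩, hg⟩ := hg
    rw [coord_apply, divDiffElt_mul_of_invariant P hg, map_mul, algebraMapInv_of_mem_homog hn hgn,
      zero_mul]
  · rw [zero_mul, map_zero]
  · rw [add_mul, map_add, hg, hh, add_zero]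
  · rw [smul_eq_mul, mul_assoc, mul_left_comm]
    exact hg (b * a)

variable [Fintype ι] [P.IsReduced]

theorem coord_of_length_ne (hρ : IsRegular P ρ) {v : P.weylGroup} {n : ℕ}
    {f : SymmetricAlgebra 𝕜 M} (hf : f ∈ homog 𝕜 M n) (h : length P ρ v ≠ n) :
    coord P ρ v f = 0 := by
  rw [coord_apply]
  rcases lt_or_gt_of_ne h with h | h
  · exact algebraMapInv_of_mem_homog (Nat.sub_pos_of_lt h) (divDiffElt_mem_homog P hρ v hf)
  · rw [divDiffElt_eq_zero_of_lt P hρ v hf h, map_zero]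

theorem schubert_mem_homog (hρ : IsRegular P ρ) (w : P.weylGroup) :
    schubert P ρ w ∈ homog 𝕜 M (length P ρ w) := by
  have h := divDiffElt_mem_homog P hρ (w⁻¹ * longest P ρ) (topSchubert_mem_homog P hρ)
  rwa [← length_inv_mul_longest P hρ w, Nat.add_sub_cancel_left] at h

open Classical in
/-- `∂_v S_w = ∂_v ∂_{w⁻¹w₀} S_{w₀}` is `∂_{w₀} S_{w₀} = 1` for `v = w`; otherwise lengths do not
add in `v · w⁻¹w₀`, because `w₀` is the only element of its length. -/
theorem divDiffElt_schubert (hρ : IsRegular P ρ) {v w : P.weylGroup}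
    (h : length P ρ v = length P ρ w) :
    divDiffElt P ρ v (schubert P ρ w) = if v = w then 1 else 0 := by
  have hw := length_inv_mul_longest P hρ w
  rw [schubert]
  split_ifs with hvw
  · subst hvw
    rw [divDiffElt_divDiffElt P hρ, mul_inv_cancel_left, divDiffElt_longest_topSchubert P hρ]
    rw [mul_inv_cancel_left, ← hw, add_comm]
  · refine divDiffElt_divDiffElt_eq_zero P hρ (fun h' => hvw ?_) _
    have := eq_longest P hρ (w := v * (w⁻¹ * longest P ρ)) (by omega)
    rw [← mul_assoc] at this
    exact mul_inv_eq_one.1 (mul_eq_right.1 this)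

open Classical in
theorem coord_schubert (hρ : IsRegular P ρ) (v w : P.weylGroup) :
    coord P ρ v (schubert P ρ w) = if v = w then 1 else 0 := by
  by_cases h : length P ρ v = length P ρ w
  · rw [coord_apply, divDiffElt_schubert P hρ h]
    split_ifs <;> simp
  · rw [coord_of_length_ne P hρ (schubert_mem_homog P hρ w) h, if_neg]
    rintro rfl
    exact h rfl

/-- A homogeneous polynomial all of whose Schubert coordinates vanish lies in the ideal generated
by the invariants of positive degree. By induction on the degree, its divided differences `∂_s f`
lie in this ideal, so `f` is congruent to `s f` for every simple reflection `s`, and hence to its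
average over `W`. -/
theorem mem_invariantIdeal (hρ : IsRegular P ρ) {n : ℕ} {f : SymmetricAlgebra 𝕜 M}
    (hf : f ∈ homog 𝕜 M n) (h : ∀ v, coord P ρ v f = 0) : f ∈ invariantIdeal P := by
  induction n generalizing f with
  | zero =>
    obtain ⟨c, rfl⟩ := mem_homog_zero hf
    have h1 := h 1
    rw [coord_apply, divDiffElt_one P hρ, SymmetricAlgebra.algebraMap_leftInverse] at h1
    rw [h1, map_zero]
    exact zero_mem _
  | succ n ih =>
    have hs : ∀ s ∈ simple P ρ, f - polyAct P (refl P s) f ∈ invariantIdeal P := by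
      intro s hs
      rw [← rootPoly_mul_divDiff]
      refine Ideal.mul_mem_left _ _ (ih (divDiff_mem_homog P s hf) fun v => ?_)
      rw [coord_apply, ← divDiffElt_refl P hρ hs]
      by_cases hl : length P ρ (v * refl P s) = length P ρ v + length P ρ (refl P s)
      · rw [divDiffElt_divDiffElt P hρ hl]
        exact h _
      · rw [divDiffElt_divDiffElt_eq_zero P hρ hl, map_zero]
    have hw : ∀ w : P.weylGroup, f - polyAct P w f ∈ invariantIdeal P := by
      intro w
      obtain ⟨l, rfl, -⟩ := exists_isReducedWord P hρ w
      induction l with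
      | nil => simp
      | cons s l ihl =>
        have h1 := add_mem (hs s s.2) (polyAct_mem_invariantIdeal P (refl P s) ihl)
        rw [map_sub, sub_add_sub_cancel, ← polyAct_mul, ← wordProd_cons] at h1
        exact h1
    let _ : Fintype P.weylGroup := Fintype.ofFinite _
    have havg : ∑ w : P.weylGroup, polyAct P w f ∈ invariantIdeal P := by
      refine Ideal.subset_span ⟨⟨n + 1, n.succ_pos, sum_mem fun w _ => polyAct_mem_homog P w hf⟩,
        fun v => ?_⟩
      simp only [map_sum, ← polyAct_mul]
      exact Equiv.sum_comp (Equiv.mulLeft v) fun w => polyAct P w f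
    have hsum : (Fintype.card P.weylGroup : 𝕜) • f ∈ invariantIdeal P := by
      have h1 := add_mem (sum_mem fun w (_ : w ∈ Finset.univ) => hw w) havg
      rw [← Finset.sum_add_distrib] at h1
      simpa [Nat.cast_smul_eq_nsmul] using h1
    have h1 := Submodule.smul_of_tower_mem (invariantIdeal P)
      (Fintype.card P.weylGroup : 𝕜)⁻¹ hsum
    rwa [smul_smul, inv_mul_cancel₀, one_smul] at h1
    exact_mod_cast Fintype.card_ne_zero

theorem mk_eq_sum_coord [Fintype P.weylGroup] (hρ : IsRegular P ρ) {n : ℕ}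
    {f : SymmetricAlgebra 𝕜 M} (hf : f ∈ homog 𝕜 M n) :
    (Ideal.Quotient.mk (invariantIdeal P) f : Coinvariant P) =
      ∑ w, coord P ρ w f • (Ideal.Quotient.mk (invariantIdeal P) (schubert P ρ w) : Coinvariant P) := by
  classical
  have h : f - ∑ w, coord P ρ w f • schubert P ρ w ∈ invariantIdeal P := by
    refine mem_invariantIdeal P hρ (n := n) (sub_mem hf (sum_mem fun w _ => ?_)) fun v => ?_
    · by_cases hw : length P ρ w = n
      · exact Submodule.smul_mem _ _ (hw ▸ schubert_mem_homog P hρ w)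
      · rw [coord_of_length_ne P hρ hf hw, zero_smul]
        exact zero_mem _
    · simp [coord_schubert P hρ]
  rw [Ideal.Quotient.mk_eq_mk_iff_sub_mem _ _ |>.2 h, map_sum]
  rfl

theorem isSchubertExpansion_iff (hρ : IsRegular P ρ) (u v : P.weylGroup) (c : P.weylGroup → 𝕜) :
    IsSchubertExpansion P ρ u v c ↔
      ∀ w, c w = coord P ρ w (schubert P ρ u * schubert P ρ v) := by
  classical
  let _ : Fintype P.weylGroup := Fintype.ofFinite _
  rw [IsSchubertExpansion, finsum_eq_sum_of_fintype]
  constructor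
  · intro h w
    have h1 : (Ideal.Quotient.mk (invariantIdeal P) (∑ w, c w • schubert P ρ w) : Coinvariant P) =
        ∑ w, c w • (Ideal.Quotient.mk (invariantIdeal P) (schubert P ρ w) : Coinvariant P) := by
      rw [map_sum]
      rfl
    rw [← h1, Ideal.Quotient.mk_eq_mk_iff_sub_mem] at h
    have h2 := coord_of_mem_invariantIdeal P (ρ := ρ) w h
    rw [map_sub, sub_eq_zero] at h2
    rw [h2]
    simp [coord_schubert P hρ]
  · intro h
    obtain rfl : c = _ := funext h
    exact mk_eq_sum_coord P hρ
      (mul_mem_homog (schubert_mem_homog P hρ u) (schubert_mem_homog P hρ v))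

theorem existsUnique_isSchubertExpansion (hρ : IsRegular P ρ) (u v : P.weylGroup) :
    ∃! c : P.weylGroup → 𝕜, IsSchubertExpansion P ρ u v c := by
  simp only [isSchubertExpansion_iff P hρ]
  exact ⟨_, fun w => rfl, fun c hc => funext hc⟩

theorem structureConst_eq (hρ : IsRegular P ρ) (u v w : P.weylGroup) :
    structureConst P ρ u v w = coord P ρ w (schubert P ρ u * schubert P ρ v) := by
  have h := (existsUnique_isSchubertExpansion P hρ u v).exists
  rw [structureConst, dif_pos h]
  exact (isSchubertExpansion_iff P hρ u v _).1 h.choose_spec w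

/-! ### Parabolic factorizations -/

/-- For `s ∈ J` the element `us` is longer than `u`, so `∂_s S_u = 0`. -/
theorem polyAct_schubert_of_mem_minCosetReps (hρ : IsRegular P ρ) {J : Set ι}
    {u : P.weylGroup} (hu : u ∈ minCosetReps P ρ J) {s : ι}
    (hs : s ∈ simple P ρ) (hsJ : s ∈ J) :
    polyAct P (refl P s) (schubert P ρ u) = schubert P ρ u := by
  rw [← divDiff_eq_zero_iff, ← divDiffElt_refl P hρ hs, schubert]
  refine divDiffElt_divDiffElt_eq_zero P hρ (fun h => ?_) _
  have h1 := hu _ (Subgroup.subset_closure ⟨s, hsJ, rfl⟩)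
  have h2 := length_inv_mul_longest P hρ u
  have h3 := length_inv_mul_longest P hρ (u * refl P s)
  rw [length_refl P hρ hs] at h
  rw [mul_inv_rev, refl_inv, mul_assoc] at h3
  omega

open Classical in
/-- Since `S_u` is `W_J`-invariant, `∂_{u x'} (S_u S_x) = ∂_u (S_u ∂_{x'} S_x)`. -/
theorem structureConst_mul (hρ : IsRegular P ρ) {J : Set ι} (hJ : J ⊆ simple P ρ)
    {u x x' : P.weylGroup} (hu : u ∈ minCosetReps P ρ J) (hx' : x' ∈ parabolic P J) :
    structureConst P ρ u x (u * x') = if x' = x then 1 else 0 := by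
  have hlen := length_mul_of_mem_minCosetReps P hρ hJ hu hx'
  rw [structureConst_eq P hρ]
  by_cases h : length P ρ x' = length P ρ x
  · obtain ⟨l, ⟨hl, hl'⟩, hlJ⟩ := exists_reducedWord_of_mem_parabolic P hρ hJ hx'
    have h1 : divDiffElt P ρ x' (schubert P ρ u * schubert P ρ x) =
        schubert P ρ u * divDiffElt P ρ x' (schubert P ρ x) := by
      rw [← hl, ← divDiffWord_eq_divDiffElt P hρ (by rw [hl, hl']),
        ← divDiffWord_eq_divDiffElt P hρ (by rw [hl, hl'])]
      exact divDiffWord_mul_of_invariant P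
        (fun s hs => polyAct_schubert_of_mem_minCosetReps P hρ hu s.2 (hlJ s hs)) _
    rw [coord_apply, ← divDiffElt_divDiffElt P hρ hlen, h1, divDiffElt_schubert P hρ h]
    split_ifs
    · rw [mul_one, divDiffElt_schubert P hρ rfl, if_pos rfl, map_one]
    · rw [mul_zero, ← divDiffEltLin_apply, map_zero, map_zero]
  · rw [coord_of_length_ne P hρ
      (mul_mem_homog (schubert_mem_homog P hρ u) (schubert_mem_homog P hρ x)), if_neg]
    · rintro rfl
      exact h rfl
    · omega

end Schubert

end HillerSchubert

end

open HillerSchubert Classical in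
theorem lemma2p2 {ι 𝕜 M N : Type*} [Fintype ι]
    [Field 𝕜] [LinearOrder 𝕜] [IsStrictOrderedRing 𝕜]
    [AddCommGroup M] [Module 𝕜 M] [AddCommGroup N] [Module 𝕜 N]
    (P : RootPairing ι 𝕜 M N) [P.IsReduced] (ρ : N) (hρ : IsRegular P ρ) :
    (∀ u v : P.weylGroup,
      (∃! c : P.weylGroup → 𝕜, IsSchubertExpansion P ρ u v c) ∧
      ∀ w, length P ρ w ≠ length P ρ u + length P ρ v → structureConst P ρ u v w = 0) ∧
    ∀ J ⊆ simple P ρ, ∀ u ∈ minCosetReps P ρ J,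
      ∀ x ∈ parabolic P J, ∀ x' ∈ parabolic P J, ∀ w w' : P.weylGroup,
        w = u * x → w' = u * x' →
          structureConst P ρ u x w' = (if w' = w then 1 else 0) ∧
          structureConst P ρ u x w' = (if x' = x then 1 else 0) := by
  refine ⟨fun u v => ⟨existsUnique_isSchubertExpansion P hρ u v, fun w hw => ?_⟩, ?_⟩
  · rw [structureConst_eq P hρ]
    exact coord_of_length_ne P hρ
      (mul_mem_homog (schubert_mem_homog P hρ u) (schubert_mem_homog P hρ v)) hw
  · rintro J hJ u hu x - x' hx' w w' rfl rfl
    have h := structureConst_mul P hρ hJ (x := x) hu hx'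
    exact ⟨by simp only [h, mul_right_inj], by simp only [h]⟩
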